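/- Let $W=\bigoplus_{k\ge 0}W^{-k}$ be a non-positively graded finite-dimensional real vector space, let $U\subset W^0$ be open, and let $$\mathcal A_{W|_U}=C^\infty(U)\otimes S\bigl((W^{<0})^*\bigr)$$ be the graded-commutative algebra in which $C^\infty(U)$ has degree $0$, elements of $(W^{-k})^*$ ($k\geq 1$) have degree $k$, and $S$ denotes the free graded-commutative algebra; linear forms on $W^0$ are regarded as elements of $C^\infty(U)$, so that $W^*\subset\mathcal A_{W|_U}$. Let $Q$ be a differential on $\mathcal A_{W|_U}$, i.e. an $\mathbb R$-linear graded derivation of degree $1$ with $Q^2=0$. Let $N\subset\mathbb R^n$ be an $n$-dimensional submanifold with corners that is star-shaped with respect to the origin. Put $\Omega(N,W)^m=\bigoplus_{k\ge0}\Omega^{m+k}(N)\otimes W^{-k}$ (smooth forms), and let $\Omega(N,W|_U)^0\subset\Omega(N,W)^0$ be the set of those $A$ whose $0$-form part (a map $N\to W^0$) takes values in $U$. Such an $A$ determines a morphism of graded algebras $\mathcal A_{W|_U}\to\Omega(N)$, $F\mapsto F(A)$, given by $f\mapsto f\circ A^{(0)}$ for $f\in C^\infty(U)$, where $A^{(0)}$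 is the $0$-form part of $A$, and by $\xi\mapsto\langle A,\xi\rangle$ for $\xi\in W^*$. Define $F_Q(A)\in\Omega(N,W)^1$ by $\langle F_Q(A),\xi\rangle=(Q\xi)(A)$ for all $\xi\in W^*$. Let $h:\Omega^{\bullet}(N)\to\Omega^{\bullet-1}(N)$ be the de Rham homotopy operator of the radial contraction $R(x,t)=tx$, i.e. for $\alpha\in\Omega^{k+1}(N)$ $$(h\alpha)_x(v_1,\dots,v_k)=\int_0^1 t^{k}\,\alpha_{tx}(x,v_1,\dots,v_k)\,dt ,$$ extended to $W$-valued forms componentwise. Then for every $A\in\Omega(N,W|_U)^0$ the form $$B=A-h(F_Q(A))$$ belongs to $\Omega(N,W)^0$, and $A$ satisfies the generalized Maurer–Cartan equation $dA=F_Q(A)$ if and only if $dB=0$. -/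

import Mathlib

noncomputable section

namespace GradedMC

open scoped Manifold ContDiff TensorProduct DirectSum
open TopologicalSpace

/-! ### The exterior algebra of the dual space and alternating forms -/

/-- The space `ℝⁿ`. -/
abbrev E (n : ℕ) : Type := EuclideanSpace ℝ (Fin n)

/-- The algebra `⋀ (ℝⁿ)*` with the wedge product. -/
abbrev Lam (n : ℕ) : Type := ExteriorAlgebra ℝ (Module.Dual ℝ (E n))

/-- The standard basis `e₁, …, eₙ` of `ℝⁿ`. -/
abbrev stdBasis (n : ℕ) : Module.Basis (Fin n) ℝ (E n) :=
  (EuclideanSpace.basisFun (Fin n) ℝ).toBasis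

theorem multilinear_expand {M F ι : Type*} [AddCommGroup M] [Module ℝ M] [AddCommGroup F]
    [Module ℝ F] [Fintype ι] [DecidableEq ι] (b : Module.Basis ι ℝ M) {k : ℕ}
    (f : MultilinearMap ℝ (fun _ : Fin k => M) F) (v : Fin k → M) :
    f v = ∑ g : Fin k → ι, (∏ i, b.coord (g i) (v i)) • f (fun i => b (g i)) := by
  have h : v = fun i => ∑ j, b.coord j (v i) • b j := by
    funext i
    simp
  conv_lhs => rw [h, MultilinearMap.map_sum]
  exact Finset.sum_congr rfl fun g _ => f.map_smul_univ _ _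

theorem alternating_expand {M F ι : Type*} [AddCommGroup M] [Module ℝ M] [AddCommGroup F]
    [Module ℝ F] [Fintype ι] [DecidableEq ι] (b : Module.Basis ι ℝ M) {k : ℕ}
    (f : M [⋀^Fin k]→ₗ[ℝ] F) (v : Fin k → M) :
    ∑ g : Fin k → ι, (Matrix.of fun i j => b.coord (g j) (v i)).det • f (fun i => b (g i)) =
      (k.factorial : ℝ) • f v := by
  simp only [Matrix.det_apply, Matrix.of_apply, Finset.sum_smul]
  rw [Finset.sum_comm]
  have key : ∀ σ : Equiv.Perm (Fin k), ∑ g : Fin k → ι,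
      (Equiv.Perm.sign σ • ∏ i, b.coord (g i) (v (σ i))) • f (fun i => b (g i)) = f v := by
    intro σ
    have h1 := multilinear_expand b f.toMultilinearMap (v ∘ σ)
    have h2 : f (v ∘ σ) = Equiv.Perm.sign σ • f v := f.map_perm v σ
    simp only [smul_assoc, ← Finset.smul_sum]
    have h3 : ∑ g : Fin k → ι, (∏ i, b.coord (g i) (v (σ i))) • f (fun i => b (g i)) =
        f (v ∘ σ) := h1.symm
    rw [h3, h2, smul_smul, Int.units_mul_self, one_smul]
  rw [Finset.sum_congr rfl fun σ _ => key σ]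
  simp [Finset.card_univ, Fintype.card_perm, Nat.cast_smul_eq_nsmul]

/-- On `ℝⁿ` every alternating form is continuous. -/
def toContAlt {n k : ℕ} (f : E n [⋀^Fin k]→ₗ[ℝ] ℝ) : E n [⋀^Fin k]→L[ℝ] ℝ :=
  { f with
    cont := by
      have h : (f : (Fin k → E n) → ℝ) = fun v => ∑ g : Fin k → Fin n,
          (∏ i, (stdBasis n).coord (g i) (v i)) • f (fun i => stdBasis n (g i)) :=
        funext fun v => multilinear_expand (stdBasis n) f.toMultilinearMap v
      change Continuous (f : (Fin k → E n) → ℝ)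
      rw [h]
      refine continuous_finsetSum _ fun g _ => ?_
      have hp : Continuous fun v : Fin k → E n => ∏ i, (stdBasis n).coord (g i) (v i) := by
        refine continuous_finsetProd _ fun i _ => ?_
        have hc : Continuous ((stdBasis n).coord (g i)) :=
          LinearMap.continuous_of_finiteDimensional _
        exact hc.comp (continuous_apply i)
      exact hp.smul continuous_const }

/-- The map `⋀ᵏ (ℝⁿ)* → Altᵏ(ℝⁿ)`, with
`(φ₁ ∧ ⋯ ∧ φₖ)(v₁, …, vₖ) = det (φⱼ (vᵢ))`. -/
def toAlt (n k : ℕ) : (⋀[ℝ]^k (Module.Dual ℝ (E n))) →ₗ[ℝ] E n [⋀^Fin k]→L[ℝ] ℝ where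
  toFun a := toContAlt
    (exteriorPower.alternatingMapLinearEquiv.symm (exteriorPower.pairingDual ℝ (E n) k a))
  map_add' a b := by ext v; simp [toContAlt]; rfl
  map_smul' c a := by ext v; simp [toContAlt]; rfl

theorem toAlt_ιMulti {n k : ℕ} (φ : Fin k → Module.Dual ℝ (E n)) (v : Fin k → E n) :
    toAlt n k (exteriorPower.ιMulti ℝ k φ) v = (Matrix.of fun i j => φ j (v i)).det := by
  change exteriorPower.alternatingMapLinearEquiv.symm _ v = _
  rw [exteriorPower.alternatingMapLinearEquiv_symm_apply]
  exact exteriorPower.pairingDual_ιMulti_ιMulti φ v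

/-- The map `Altᵏ(ℝⁿ) → ⋀ᵏ (ℝⁿ)*`,
`α ↦ (1/k!) ∑ α(e_{g₁}, …, e_{gₖ}) dx^{g₁} ∧ ⋯ ∧ dx^{gₖ}`. -/
def ofAlt (n k : ℕ) : (E n [⋀^Fin k]→L[ℝ] ℝ) →ₗ[ℝ] ⋀[ℝ]^k (Module.Dual ℝ (E n)) where
  toFun α := (k.factorial : ℝ)⁻¹ • ∑ g : Fin k → Fin n,
    α (fun i => stdBasis n (g i)) •
      exteriorPower.ιMulti ℝ k (fun i => (stdBasis n).coord (g i))
  map_add' a b := by simp [add_smul, Finset.sum_add_distrib]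
  map_smul' c a := by
    simp only [ContinuousAlternatingMap.smul_apply, smul_assoc, ← Finset.smul_sum,
      RingHom.id_apply]
    rw [smul_comm]

/-- The identification `⋀ᵏ (ℝⁿ)* ≃ Altᵏ(ℝⁿ)`. -/
def formEquiv (n k : ℕ) :
    (⋀[ℝ]^k (Module.Dual ℝ (E n))) ≃ₗ[ℝ] E n [⋀^Fin k]→L[ℝ] ℝ :=
  LinearEquiv.ofLinearMap (toAlt n k) (ofAlt n k)
    (by
      ext α v
      have h := alternating_expand (stdBasis n) α.toAlternatingMap v
      simp only [LinearMap.comp_apply, LinearMap.id_apply, ofAlt, LinearMap.coe_mk,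
        AddHom.coe_mk, map_smul, map_sum, ContinuousAlternatingMap.smul_apply,
        ContinuousAlternatingMap.sum_apply, toAlt_ιMulti]
      rw [inv_smul_eq_iff₀ (by positivity)]
      refine Eq.trans ?_ h
      exact Finset.sum_congr rfl fun g _ => mul_comm _ _)
    (by
      apply exteriorPower.linearMap_ext
      ext φ
      have h := alternating_expand (stdBasis n).dualBasis
        (exteriorPower.ιMulti ℝ k (M := Module.Dual ℝ (E n))) φ
      simp only [LinearMap.compAlternatingMap_apply, LinearMap.comp_apply, LinearMap.id_apply,
        ofAlt, LinearMap.coe_mk, AddHom.coe_mk, toAlt_ιMulti]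
      congr 1
      rw [inv_smul_eq_iff₀ (by positivity), ← h]
      refine Finset.sum_congr rfl fun g _ => ?_
      rw [← Matrix.det_transpose]
      congr 2
      · ext i j
        simp
      · funext i
        simp)

/-- The `k`-form component of an element of `⋀ (ℝⁿ)*`. -/
def toForm (n k : ℕ) : Lam n →ₗ[ℝ] E n [⋀^Fin k]→L[ℝ] ℝ :=
  (formEquiv n k).toLinearMap ∘ₗ
    DirectSum.component ℝ ℕ (fun i : ℕ => ⋀[ℝ]^i (Module.Dual ℝ (E n))) k ∘ₗ
      (DirectSum.decomposeLinearEquiv fun i : ℕ => ⋀[ℝ]^i (Module.Dual ℝ (E n))).toLinearMap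

theorem ι_mul_ιMulti {M : Type*} [AddCommGroup M] [Module ℝ M] (x : M) :
    ∀ (j : ℕ) (v : Fin j → M),
      ExteriorAlgebra.ι ℝ x * ExteriorAlgebra.ιMulti ℝ j v =
        (-1 : ℝ) ^ j • (ExteriorAlgebra.ιMulti ℝ j v * ExteriorAlgebra.ι ℝ x)
  | 0, v => by simp
  | j + 1, v => by
    have h : ExteriorAlgebra.ι ℝ x * ExteriorAlgebra.ι ℝ (v 0) =
        -(ExteriorAlgebra.ι ℝ (v 0) * ExteriorAlgebra.ι ℝ x) :=
      eq_neg_of_add_eq_zero_left (ExteriorAlgebra.ι_add_mul_swap x (v 0))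
    rw [ExteriorAlgebra.ιMulti_succ_apply, ← mul_assoc, h, neg_mul, mul_assoc,
      ι_mul_ιMulti x j, mul_smul_comm, ← mul_assoc, pow_succ, mul_neg_one, neg_smul]

theorem graded_comm {M : Type*} [AddCommGroup M] [Module ℝ M] {i j : ℕ}
    {a b : ExteriorAlgebra ℝ M} (ha : a ∈ ⋀[ℝ]^i M) (hb : b ∈ ⋀[ℝ]^j M) :
    a * b = (-1 : ℝ) ^ (i * j) • (b * a) := by
  have h1 : ∀ (i : ℕ) (u : Fin i → M) (v : Fin j → M),
      ExteriorAlgebra.ιMulti ℝ i u * ExteriorAlgebra.ιMulti ℝ j v =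
        (-1 : ℝ) ^ (i * j) •
          (ExteriorAlgebra.ιMulti ℝ j v * ExteriorAlgebra.ιMulti ℝ i u) := by
    intro i
    induction i with
    | zero => intro u v; simp
    | succ i ih =>
      intro u v
      rw [ExteriorAlgebra.ιMulti_succ_apply, mul_assoc, ih, mul_smul_comm, ← mul_assoc,
        ι_mul_ιMulti, smul_mul_assoc, smul_smul, mul_assoc, ← pow_add, Nat.succ_mul]
  rw [← ExteriorAlgebra.ιMulti_span_fixedDegree] at ha hb
  induction ha using Submodule.span_induction with
  | mem a ha =>
    obtain ⟨u, rfl⟩ := ha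
    induction hb using Submodule.span_induction with
    | mem b hb => obtain ⟨v, rfl⟩ := hb; exact h1 i u v
    | zero => simp
    | add b b' _ _ h h' => rw [mul_add, add_mul, smul_add, h, h']
    | smul c b _ h => rw [mul_smul_comm, smul_mul_assoc, h, smul_comm]
  | zero => simp
  | add a a' _ _ h h' => rw [mul_add, add_mul, smul_add, h, h']
  | smul c a _ h => rw [mul_smul_comm, smul_mul_assoc, h, smul_comm]

/-! ### The algebra of functions on the graded manifold `W|_U`

A non-positively graded vector space `W = ⨁ W⁻ᵏ` is given by the family `k ↦ W k`, where `W k`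
is the component of degree `-k`; linear coordinates on `W k` have degree `k`. -/

section Algebra

variable (W : ℕ → Type*) [∀ k, NormedAddCommGroup (W k)] [∀ k, NormedSpace ℝ (W k)]

/-- The dual `(W^{<0})*`; the summand with index `k` is the dual of the component of degree
`-(k+1)`. -/
abbrev NegDual : Type _ := ⨁ k : ℕ, StrongDual ℝ (W (k + 1))

/-- The generator of the tensor algebra given by a linear form on the component of degree
`-(k+1)`. -/
def tgen (k : ℕ) (ξ : StrongDual ℝ (W (k + 1))) : TensorAlgebra ℝ (NegDual W) :=
  TensorAlgebra.ι ℝ (DirectSum.lof ℝ ℕ (fun k => StrongDual ℝ (W (k + 1))) k ξ)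

/-- Graded commutativity: `ξ η = (-1)^{deg ξ deg η} η ξ`. -/
inductive SymRel : TensorAlgebra ℝ (NegDual W) → TensorAlgebra ℝ (NegDual W) → Prop
  | comm (i j : ℕ) (ξ : StrongDual ℝ (W (i + 1))) (η : StrongDual ℝ (W (j + 1))) :
      SymRel (tgen W i ξ * tgen W j η)
        ((-1 : ℝ) ^ ((i + 1) * (j + 1)) • (tgen W j η * tgen W i ξ))

/-- The free graded-commutative algebra `S((W^{<0})*)`. -/
abbrev GradedSym : Type _ := RingQuot (SymRel W)

/-- The generator of degree `k+1` of `S((W^{<0})*)` given by a linear form on the component of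
degree `-(k+1)`. -/
def sgen (k : ℕ) : StrongDual ℝ (W (k + 1)) →ₗ[ℝ] GradedSym W :=
  (RingQuot.mkAlgHom ℝ (SymRel W)).toLinearMap ∘ₗ TensorAlgebra.ι ℝ ∘ₗ
    DirectSum.lof ℝ ℕ (fun k => StrongDual ℝ (W (k + 1))) k

/-- The homogeneous component of degree `m` of `S((W^{<0})*)`. -/
def symDeg (m : ℕ) : Submodule ℝ (GradedSym W) :=
  Submodule.span ℝ {s | ∃ L : List (Σ k : ℕ, StrongDual ℝ (W (k + 1))),
    (L.map fun p => p.1 + 1).sum = m ∧ s = (L.map fun p => sgen W p.1 p.2).prod}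

variable {W}

/-- The algebra `C^∞(U)`. -/
abbrev Smooth (U : Opens (W 0)) : Type _ := C^∞⟮𝓘(ℝ, W 0), U; 𝓘(ℝ, ℝ), ℝ⟯

/-- The algebra `𝒜_{W|_U} = C^∞(U) ⊗ S((W^{<0})*)`. -/
abbrev Alg (U : Opens (W 0)) : Type _ := Smooth U ⊗[ℝ] GradedSym W

/-- The homogeneous component of degree `m` of `𝒜_{W|_U}` (elements of `C^∞(U)` have
degree `0`). -/
def algDeg (U : Opens (W 0)) (m : ℕ) : Submodule ℝ (Alg U) :=
  Submodule.span ℝ {a | ∃ (f : Smooth U) (s : GradedSym W), s ∈ symDeg W m ∧ a = f ⊗ₜ[ℝ] s}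

/-- The restriction to `U` of a linear form on `W⁰`. -/
def linSmooth (U : Opens (W 0)) : StrongDual ℝ (W 0) →ₗ[ℝ] Smooth U where
  toFun ξ := ⟨fun u => ξ u, ξ.contMDiff.comp contMDiff_subtype_val⟩
  map_add' _ _ := rfl
  map_smul' _ _ := rfl

/-- The inclusion `W* → 𝒜_{W|_U}`. -/
def coordFn (U : Opens (W 0)) : ∀ k : ℕ, StrongDual ℝ (W k) →ₗ[ℝ] Alg U
  | 0 => (Algebra.TensorProduct.includeLeft (R := ℝ) (S := ℝ) (A := Smooth U)
      (B := GradedSym W)).toLinearMap ∘ₗ linSmooth U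
  | k + 1 => (Algebra.TensorProduct.includeRight (R := ℝ) (A := Smooth U)
      (B := GradedSym W)).toLinearMap ∘ₗ sgen W k

/-- A differential on the graded algebra `𝒜_{W|_U}`: a derivation of degree `1` with
square zero. -/
structure Differential (U : Opens (W 0)) where
  /-- The underlying linear map. -/
  Q : Alg U →ₗ[ℝ] Alg U
  degree : ∀ (m : ℕ) (a : Alg U), a ∈ algDeg U m → Q a ∈ algDeg U (m + 1)
  leibniz : ∀ (m : ℕ) (a b : Alg U), a ∈ algDeg U m →
    Q (a * b) = Q a * b + (-1 : ℝ) ^ m • (a * Q b)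
  sq_zero : ∀ a : Alg U, Q (Q a) = 0

/-! ### Substituting forms for coordinates -/

/-- The pairing `⟨a, ξ⟩ ∈ ⋀ᵏ (ℝⁿ)*` of a `W⁻ᵏ`-valued alternating `k`-form with a linear form on
`W⁻ᵏ`. -/
def pair {n k : ℕ} (a : E n [⋀^Fin k]→L[ℝ] W k) :
    StrongDual ℝ (W k) →ₗ[ℝ] ⋀[ℝ]^k (Module.Dual ℝ (E n)) where
  toFun ξ := (formEquiv n k).symm (ξ.compContinuousAlternatingMap a)
  map_add' ξ η := by rw [← map_add]; rfl
  map_smul' c ξ := by rw [RingHom.id_apply, ← map_smul]; rfl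

/-- The morphism `S((W^{<0})*) → ⋀ (ℝⁿ)*` with `ξ ↦ ⟨a, ξ⟩`. -/
def evalSym {n : ℕ} (a : ∀ k, E n [⋀^Fin k]→L[ℝ] W k) : GradedSym W →ₐ[ℝ] Lam n :=
  RingQuot.liftAlgHom ℝ
    ⟨TensorAlgebra.lift ℝ (DirectSum.toModule ℝ ℕ (Lam n)
      fun k => (⋀[ℝ]^(k + 1) (Module.Dual ℝ (E n))).subtype ∘ₗ pair (a (k + 1))), by
      rintro _ _ ⟨i, j, ξ, η⟩
      simp only [tgen, map_mul, map_smul, TensorAlgebra.lift_ι_apply, DirectSum.toModule_lof]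
      exact graded_comm (Subtype.mem _) (Subtype.mem _)⟩

/-- Evaluation of smooth functions at a point of `U`. -/
def evalSmooth (U : Opens (W 0)) (u : U) : Smooth U →ₐ[ℝ] ℝ :=
  { ContMDiffMap.evalRingHom u with commutes' := by intro r; rfl }

theorem eval_commute {n : ℕ} (U : Opens (W 0)) (a : ∀ k, E n [⋀^Fin k]→L[ℝ] W k) (u : U)
    (f : Smooth U) (s : GradedSym W) :
    Commute (((Algebra.ofId ℝ (Lam n)).comp (evalSmooth U u)) f) (evalSym a s) :=
  Algebra.commutes (evalSmooth U u f) (evalSym a s)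

/-- The morphism of graded algebras `𝒜_{W|_U} → ⋀ (ℝⁿ)*` determined by
`a ∈ ⨁ₖ ⋀ᵏ (ℝⁿ)* ⊗ W⁻ᵏ` with `0`-form part in `U`: `f ↦ f(a₀)` for `f ∈ C^∞(U)` and
`ξ ↦ ⟨a, ξ⟩` for `ξ ∈ W*`. -/
def evalAlg {n : ℕ} (U : Opens (W 0)) (a : ∀ k, E n [⋀^Fin k]→L[ℝ] W k) (ha : a 0 ![] ∈ U) :
    Alg U →ₐ[ℝ] Lam n :=
  Algebra.TensorProduct.lift ((Algebra.ofId ℝ (Lam n)).comp (evalSmooth U ⟨a 0 ![], ha⟩))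
    (evalSym a) (eval_commute U a ⟨a 0 ![], ha⟩)

/-! ### Forms on `N`, the generalized Maurer–Cartan equation and the Kuranishi transform -/

/-- The underlying data of an element of `Ω(N, W)⁰`: a `W⁻ᵏ`-valued `k`-form for every `k`. Only
the values on `N` are relevant. -/
abbrev Form0 (n : ℕ) (W : ℕ → Type*) [∀ k, NormedAddCommGroup (W k)]
    [∀ k, NormedSpace ℝ (W k)] : Type _ :=
  ∀ k : ℕ, E n → E n [⋀^Fin k]→L[ℝ] W k

/-- The underlying data of an element of `Ω(N, W)¹`: a `W⁻ᵏ`-valued `(k+1)`-form for every `k`. -/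
abbrev Form1 (n : ℕ) (W : ℕ → Type*) [∀ k, NormedAddCommGroup (W k)]
    [∀ k, NormedSpace ℝ (W k)] : Type _ :=
  ∀ k : ℕ, E n → E n [⋀^Fin (k + 1)]→L[ℝ] W k

/-- Smoothness on a subset `N ⊆ ℝⁿ`: on `N` the function agrees with a smooth function defined on
an open neighbourhood of `N`. -/
def SmoothOn {n : ℕ} {F : Type*} [NormedAddCommGroup F] [NormedSpace ℝ F] (N : Set (E n))
    (f : E n → F) : Prop :=
  ∃ (O : Set (E n)) (g : E n → F), IsOpen O ∧ N ⊆ O ∧ ContDiffOn ℝ ∞ g O ∧ Set.EqOn f g N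

/-- `A ∈ Ω(N, W)⁰`. -/
def IsForm0 {n : ℕ} (N : Set (E n)) (A : Form0 n W) : Prop :=
  ∀ k, SmoothOn N (A k)

/-- `A ∈ Ω(N, W|_U)⁰`. -/
def IsForm0In {n : ℕ} (N : Set (E n)) (U : Opens (W 0)) (A : Form0 n W) : Prop :=
  IsForm0 N A ∧ ∀ x ∈ N, A 0 x ![] ∈ U

/-- The exterior derivative on `N`. -/
def dForm {n : ℕ} (N : Set (E n)) (A : Form0 n W) : Form1 n W :=
  fun k x => extDerivWithin (A k) N x

variable [∀ k, FiniteDimensional ℝ (W k)]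

open Classical in
/-- `F_Q(A) ∈ Ω(N, W)¹`, determined at the points of `N` by `⟨F_Q(A), ξ⟩ = (Q ξ)(A)` for all
`ξ ∈ W*`, see `pairing_FQ`. (The value at points where the `0`-form part of `A` is not in `U` is
irrelevant.) -/
def FQ {n : ℕ} {U : Opens (W 0)} (Q : Differential U) (A : Form0 n W) : Form1 n W :=
  fun k x =>
    if hx : A 0 x ![] ∈ U then
      ∑ i, (ContinuousLinearMap.toSpanSingleton ℝ
          (Module.finBasis ℝ (W k) i)).compContinuousAlternatingMap
        (toForm n (k + 1) (evalAlg U (fun j => A j x) hx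
          (Q.Q (coordFn U k (LinearMap.toContinuousLinearMap
            ((Module.finBasis ℝ (W k)).coord i))))))
    else 0

theorem pairing_FQ {n : ℕ} {U : Opens (W 0)} (Q : Differential U) (A : Form0 n W) (k : ℕ)
    (x : E n) (hx : A 0 x ![] ∈ U) (ξ : StrongDual ℝ (W k)) :
    ξ.compContinuousAlternatingMap (FQ Q A k x) =
      toForm n (k + 1) (evalAlg U (fun j => A j x) hx (Q.Q (coordFn U k ξ))) := by
  have hξ : ξ = ∑ i, ξ (Module.finBasis ℝ (W k) i) •
      LinearMap.toContinuousLinearMap ((Module.finBasis ℝ (W k)).coord i) := by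
    ext w
    conv_lhs => rw [← (Module.finBasis ℝ (W k)).sum_repr w, map_sum]
    simp only [map_smul, smul_eq_mul]
    simp [mul_comm]
  conv_rhs => rw [hξ]
  ext v
  simp [FQ, hx, mul_comm]

/-- The de Rham homotopy operator of the contraction `R(x, t) = t x`, the fibre integral of
`i_{∂_t} R^*`: for a `(k+1)`-form `α`,
`(h α)_x(v₁, …, vₖ) = ∫₀¹ α_{tx}(x, t v₁, …, t vₖ) dt = ∫₀¹ tᵏ α_{tx}(x, v₁, …, vₖ) dt`. -/
def hOp {n k : ℕ} {F : Type*} [NormedAddCommGroup F] [NormedSpace ℝ F]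
    (α : E n → E n [⋀^Fin (k + 1)]→L[ℝ] F) : E n → E n [⋀^Fin k]→L[ℝ] F :=
  fun x => ∫ t in (0 : ℝ)..1, t ^ k • (α (t • x)).curryLeft x

/-- `B = A - h(F_Q(A))`. -/
def kuranishi {n : ℕ} {U : Opens (W 0)} (Q : Differential U) (A : Form0 n W) : Form0 n W :=
  fun k x => A k x - hOp (FQ Q A k) x

end Algebra

/-- `N ⊆ ℝⁿ` is an `n`-dimensional submanifold with corners: around each of its points there are
smooth coordinates of `ℝⁿ` in which `N` is given by `yᵢ ≥ 0` for `i` in some set of indices. -/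
def IsSubmanifoldWithCorners {n : ℕ} (N : Set (E n)) : Prop :=
  ∀ x ∈ N, ∃ (φ : OpenPartialHomeomorph (E n) (E n)) (S : Set (Fin n)),
    x ∈ φ.source ∧ ContDiffOn ℝ ∞ φ φ.source ∧ ContDiffOn ℝ ∞ φ.symm φ.target ∧
      ∀ y ∈ φ.source, y ∈ N ↔ ∀ i ∈ S, 0 ≤ φ y i

end GradedMC

end

/-!
Write `C = dA - F_Q(A)`. The homotopy formula `dh + hd = id` turns `dB` into `C + h(d F_Q(A))`.
Since `Q² = 0`, the form `d F_Q(A)` measures, on the elements `Q ξ`, the failure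
`F ↦ d(F(A)) - (QF)(A)` of substitution to intertwine the differentials. This failure is a graded
derivation along substitution, so it is determined by its values on linear coordinates, which are
the components of `C`; on `C^∞(U)` this is Hadamard's lemma. Hence `d F_Q(A) = O(C)` on compact
sets.

If `C = 0`, then `dB = 0`. Conversely, `dB = 0` gives `C = -h(d F_Q(A))`, so `‖C‖` at `s x` is
bounded by a multiple of the integral of `‖C‖` over the segment from `0` to `s x`, and Grönwall's
inequality gives `C = 0`.
-/

noncomputable section

namespace GradedMC

open scoped Manifold ContDiff TensorProduct DirectSum
open TopologicalSpace
open Set Filter Topology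

section ParametricIntegral

universe u v

theorem continuousOn_slice {Z T G : Type*} [TopologicalSpace Z] [TopologicalSpace T]
    [TopologicalSpace G] {g : Z × T → G} {V : Set (Z × T)} (hg : ContinuousOn g V) {K : Set T}
    {z : Z} (hz : ∀ t ∈ K, (z, t) ∈ V) : ContinuousOn (fun t => g (z, t)) K :=
  hg.comp (by fun_prop) hz

theorem eventually_forall_mem_and_norm_le {Z T G : Type*} [TopologicalSpace Z]
    [TopologicalSpace T] [SeminormedAddCommGroup G] {g : Z × T → G} {V : Set (Z × T)}
    (hV : IsOpen V) (hg : ContinuousOn g V) {K : Set T} (hK : IsCompact K) {z : Z}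
    (hz : ∀ t ∈ K, (z, t) ∈ V) :
    ∃ M, ∀ᶠ y in 𝓝 z, ∀ t ∈ K, (y, t) ∈ V ∧ ‖g (y, t)‖ ≤ M := by
  obtain ⟨M, hM⟩ := hK.exists_bound_of_continuousOn (continuousOn_slice hg hz)
  refine ⟨M + 1, hK.eventually_forall_of_forall_eventually fun t ht => ?_⟩
  have hV' : V ∈ 𝓝 (z, t) := hV.mem_nhds (hz t ht)
  have hlt : ‖g (z, t)‖ < M + 1 := (hM t ht).trans_lt (lt_add_one M)
  filter_upwards [hV', (hg.continuousAt hV').norm.eventually_lt_const hlt] with p hp hpM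
  exact ⟨hp, hpM.le⟩

variable {X : Type u} [NormedAddCommGroup X] [NormedSpace ℝ X]

/-- The partial derivative in the first variable of a function on a product. -/
def partialFst {T F : Type*} [NormedAddCommGroup T] [NormedSpace ℝ T] [NormedAddCommGroup F]
    [NormedSpace ℝ F] (f : X × T → F) (p : X × T) : X →L[ℝ] F :=
  (fderiv ℝ f p).comp (ContinuousLinearMap.inl ℝ X T)

section

variable {F : Type*} [NormedAddCommGroup F] [NormedSpace ℝ F] {f : X × ℝ → F} {V : Set (X × ℝ)}

theorem hasFDerivAt_partialFst {p : X × ℝ} (hf : DifferentiableAt ℝ f p) :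
    HasFDerivAt (fun x => f (x, p.2)) (partialFst f p) p.1 :=
  HasFDerivAt.comp p.1 (f := fun x => (x, p.2)) hf.hasFDerivAt (hasFDerivAt_prodMk_left p.1 p.2)

theorem contDiffOn_partialFst {m n : ℕ∞ω} (hV : IsOpen V) (hf : ContDiffOn ℝ n f V)
    (hmn : m + 1 ≤ n) : ContDiffOn ℝ m (partialFst f) V :=
  (hf.fderiv_of_isOpen hV hmn).clm_comp contDiffOn_const

theorem hasFDerivAt_integral_of_contDiffOn (hV : IsOpen V) (hf : ContDiffOn ℝ 1 f V) {a b : ℝ}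
    {x : X} (hx : ∀ t ∈ uIcc a b, (x, t) ∈ V) :
    HasFDerivAt (fun x => ∫ t in a..b, f (x, t)) (∫ t in a..b, partialFst f (x, t)) x := by
  have hf' : ContinuousOn (partialFst f) V :=
    (contDiffOn_partialFst (m := 0) hV hf (by simp)).continuousOn
  obtain ⟨M, hM⟩ := eventually_forall_mem_and_norm_le hV hf' isCompact_uIcc hx
  refine intervalIntegral.hasFDerivAt_integral_of_dominated_of_fderiv_le
    (F := fun x t => f (x, t)) (F' := fun x t => partialFst f (x, t)) (bound := fun _ => M)
    hM ?_ (continuousOn_slice hf.continuousOn hx).intervalIntegrable ?_ ?_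
    intervalIntegrable_const ?_
  · filter_upwards [hM] with y hy
    exact ((continuousOn_slice hf.continuousOn fun t ht => (hy t ht).1).mono
      uIoc_subset_uIcc).aestronglyMeasurable measurableSet_uIoc
  · exact ((continuousOn_slice hf' hx).mono uIoc_subset_uIcc).aestronglyMeasurable
      measurableSet_uIoc
  · exact .of_forall fun t ht y hy => (hy t (uIoc_subset_uIcc ht)).2
  · refine .of_forall fun t ht y hy => hasFDerivAt_partialFst (p := (y, t)) ?_
    exact (hf.differentiableOn one_ne_zero).differentiableAt
      (hV.mem_nhds (hy t (uIoc_subset_uIcc ht)).1)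

end

variable {O : Set X} {V : Set (X × ℝ)} {a b : ℝ}

theorem contDiffOn_nat_integral (hO : IsOpen O) (hV : IsOpen V)
    (hOV : ∀ x ∈ O, ∀ t ∈ uIcc a b, (x, t) ∈ V) (m : ℕ) :
    ∀ {F : Type max u v} [NormedAddCommGroup F] [NormedSpace ℝ F] {f : X × ℝ → F},
      ContDiffOn ℝ ∞ f V → ContDiffOn ℝ m (fun x => ∫ t in a..b, f (x, t)) O := by
  induction m with
  | zero =>
    intro F _ _ f hf
    exact contDiffOn_zero.2 fun x hx => (hasFDerivAt_integral_of_contDiffOn hV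
      (hf.of_le (by simp)) (hOV x hx)).continuousAt.continuousWithinAt
  | succ m ih =>
    intro F _ _ f hf
    have hderiv : ∀ x ∈ O, HasFDerivAt (fun x => ∫ t in a..b, f (x, t))
        (∫ t in a..b, partialFst f (x, t)) x := fun x hx =>
      hasFDerivAt_integral_of_contDiffOn hV (hf.of_le (by simp)) (hOV x hx)
    rw [Nat.cast_succ, contDiffOn_succ_iff_fderiv_of_isOpen hO]
    exact ⟨fun x hx => (hderiv x hx).differentiableAt.differentiableWithinAt, by simp,
      (ih (contDiffOn_partialFst hV hf (by simp))).congr fun x hx => (hderiv x hx).fderiv⟩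

theorem contDiffOn_integral (hO : IsOpen O) (hV : IsOpen V)
    (hOV : ∀ x ∈ O, ∀ t ∈ uIcc a b, (x, t) ∈ V)
    {F : Type max u v} [NormedAddCommGroup F] [NormedSpace ℝ F] {f : X × ℝ → F}
    (hf : ContDiffOn ℝ ∞ f V) : ContDiffOn ℝ ∞ (fun x => ∫ t in a..b, f (x, t)) O :=
  contDiffOn_infty.2 fun m => contDiffOn_nat_integral.{u, v} hO hV hOV m hf

end ParametricIntegral

section HomotopyFormula

open ContinuousAlternatingMap MeasureTheory

variable {X : Type*} [NormedAddCommGroup X] [NormedSpace ℝ X]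
  {F : Type*} [NormedAddCommGroup F] [NormedSpace ℝ F] {k : ℕ}

/-- Separation of the first argument of an alternating form, as a continuous linear map. -/
def curryLeftCLM (k : ℕ) (X F : Type*) [NormedAddCommGroup X] [NormedSpace ℝ X]
    [NormedAddCommGroup F] [NormedSpace ℝ F] :
    (X [⋀^Fin (k + 1)]→L[ℝ] F) →L[ℝ] X →L[ℝ] X [⋀^Fin k]→L[ℝ] F :=
  (curryLeftLI (𝕜 := ℝ)).toContinuousLinearMap

/-- The interior product of alternating forms with a vector. -/
def interiorProduct (x : X) : (X [⋀^Fin (k + 1)]→L[ℝ] F) →L[ℝ] X [⋀^Fin k]→L[ℝ] F :=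
  (ContinuousLinearMap.apply ℝ (X [⋀^Fin k]→L[ℝ] F) x).comp (curryLeftCLM k X F)

@[simp]
theorem interiorProduct_apply (x : X) (β : X [⋀^Fin (k + 1)]→L[ℝ] F) (v : Fin k → X) :
    interiorProduct x β v = β (Matrix.vecCons x v) :=
  rfl

theorem alternatizeUncurryFin_interiorProduct_add (D : X →L[ℝ] X [⋀^Fin (k + 1)]→L[ℝ] F) (x : X) :
    alternatizeUncurryFin ((interiorProduct x).comp D) +
      interiorProduct x (alternatizeUncurryFin D) = D x := by
  have removeNth_zero (v : Fin (k + 1) → X) : Fin.removeNth 0 (Matrix.vecCons x v) = v :=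
    Fin.removeNth_zero ..
  have removeNth_succ (v : Fin (k + 1) → X) (i : Fin (k + 1)) :
      Fin.removeNth i.succ (Matrix.vecCons x v) = Matrix.vecCons x (Fin.removeNth i v) := by
    ext j
    refine Fin.cases ?_ (fun j => ?_) j <;> simp [Fin.removeNth]
  ext v
  simp [alternatizeUncurryFin_apply, Fin.sum_univ_succ (n := k + 1), removeNth_zero,
    removeNth_succ, pow_succ]

theorem contDiffOn_extDeriv {α : X → X [⋀^Fin k]→L[ℝ] F} {O : Set X} {m n : ℕ∞ω}
    (hO : IsOpen O) (hα : ContDiffOn ℝ n α O) (hmn : m + 1 ≤ n) :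
    ContDiffOn ℝ m (extDeriv α) O :=
  ContDiff.comp_contDiffOn (g := alternatizeUncurryFinCLM ℝ X F) (by fun_prop)
    (hα.fderiv_of_isOpen hO hmn)

/-- The integrand of the homotopy operator, as a function of the point and of the parameter of the
radial contraction. -/
def hIntegrand (α : X → X [⋀^Fin (k + 1)]→L[ℝ] F) (p : X × ℝ) : X [⋀^Fin k]→L[ℝ] F :=
  p.2 ^ k • interiorProduct p.1 (α (p.2 • p.1))

variable {O : Set X} {α : X → X [⋀^Fin (k + 1)]→L[ℝ] F}

theorem isOpen_setOf_smul_mem (hO : IsOpen O) : IsOpen {p : X × ℝ | p.2 • p.1 ∈ O} :=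
  hO.preimage (by fun_prop)

theorem contDiffOn_hIntegrand {n : ℕ∞ω} (hα : ContDiffOn ℝ n α O) :
    ContDiffOn ℝ n (hIntegrand α) {p : X × ℝ | p.2 • p.1 ∈ O} := by
  have hα' : ContDiffOn ℝ n (fun p : X × ℝ => α (p.2 • p.1)) {p : X × ℝ | p.2 • p.1 ∈ O} :=
    hα.comp (contDiff_snd.smul contDiff_fst).contDiffOn fun p hp => hp
  have hcurry : ContDiffOn ℝ n (fun p : X × ℝ => curryLeftCLM k X F (α (p.2 • p.1))) _ :=
    ContDiff.comp_contDiffOn (g := curryLeftCLM k X F) (by fun_prop) hα'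
  exact (contDiff_snd.pow k).contDiffOn.smul (hcurry.clm_apply contDiff_fst.contDiffOn)

theorem partialFst_hIntegrand (hO : IsOpen O) (hα : ContDiffOn ℝ 1 α O) {x : X} {t : ℝ}
    (hx : t • x ∈ O) :
    partialFst (hIntegrand α) (x, t) =
      t ^ (k + 1) • (interiorProduct x).comp (fderiv ℝ α (t • x)) +
        t ^ k • (α (t • x)).curryLeft := by
  have hpartial : HasFDerivAt (fun y => hIntegrand α (y, t)) (partialFst (hIntegrand α) (x, t)) x :=
    hasFDerivAt_partialFst (p := (x, t)) <|
      ((contDiffOn_hIntegrand hα).differentiableOn one_ne_zero).differentiableAt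
        ((isOpen_setOf_smul_mem hO).mem_nhds hx)
  have hα' : HasFDerivAt (fun y : X => α (t • y)) (t • fderiv ℝ α (t • x)) x :=
    (((hα.differentiableOn one_ne_zero).differentiableAt (hO.mem_nhds hx)).hasFDerivAt.comp x
      ((hasFDerivAt_id x).const_smul t)).congr_fderiv (by ext; simp)
  have hcurry : HasFDerivAt (fun y : X => curryLeftCLM k X F (α (t • y))) _ x :=
    HasFDerivAt.comp x (g := curryLeftCLM k X F) (g' := curryLeftCLM k X F)
      (ContinuousLinearMap.hasFDerivAt _) hα'
  have hproduct := (hcurry.clm_apply (hasFDerivAt_id x)).const_smul (t ^ k)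
  refine (hpartial.unique hproduct).trans ?_
  ext v w
  simp [curryLeftCLM, pow_succ, mul_smul, add_comm]

/-- Cartan's formula for the radial vector field: the derivative of the pullback under the
contraction `x ↦ t • x` is `d i + i d`. -/
theorem hasDerivAt_pow_smul_comp_smul (hO : IsOpen O) (hα : ContDiffOn ℝ 1 α O) {x : X} {t : ℝ}
    (hx : t • x ∈ O) :
    HasDerivAt (fun t : ℝ => t ^ (k + 1) • α (t • x))
      (alternatizeUncurryFin (partialFst (hIntegrand α) (x, t)) + hIntegrand (extDeriv α) (x, t))
      t := by
  have hα' : HasDerivAt (fun t : ℝ => α (t • x)) (fderiv ℝ α (t • x) x) t := by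
    have hα'' := ((hα.differentiableOn one_ne_zero).differentiableAt (hO.mem_nhds hx)).hasFDerivAt
    exact (hα''.comp_hasDerivAt t ((hasDerivAt_id t).smul_const x)).congr_deriv (by simp)
  refine ((hasDerivAt_pow (k + 1) t).smul hα').congr_deriv ?_
  rw [partialFst_hIntegrand hO hα hx, alternatizeUncurryFin_add, alternatizeUncurryFin_smul,
    alternatizeUncurryFin_smul, alternatizeUncurryFin_curryLeft, hIntegrand, extDeriv,
    ← alternatizeUncurryFin_interiorProduct_add (fderiv ℝ α (t • x)) x, ← Nat.cast_smul_eq_nsmul ℝ,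
    smul_smul, Nat.add_sub_cancel, mul_comm (t ^ k)]
  module

theorem extDeriv_integral_hIntegrand_add [CompleteSpace F] (hO : IsOpen O)
    (hα : ContDiffOn ℝ ∞ α O) {x : X} (hx : ∀ t ∈ uIcc (0 : ℝ) 1, t • x ∈ O) :
    extDeriv (fun x => ∫ t in (0 : ℝ)..1, hIntegrand α (x, t)) x +
      ∫ t in (0 : ℝ)..1, hIntegrand (extDeriv α) (x, t) = α x := by
  have hV := isOpen_setOf_smul_mem hO
  have hi : ContDiffOn ℝ 1 (hIntegrand α) _ := (contDiffOn_hIntegrand hα).of_le (by simp)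
  have hdi : ContinuousOn (fun t => partialFst (hIntegrand α) (x, t)) (uIcc 0 1) :=
    continuousOn_slice (contDiffOn_partialFst (m := 0) hV hi (by simp)).continuousOn hx
  have hid : ContinuousOn (fun t => hIntegrand (extDeriv α) (x, t)) (uIcc 0 1) :=
    continuousOn_slice
      (contDiffOn_hIntegrand (contDiffOn_extDeriv (m := 0) hO hα (by simp))).continuousOn hx
  have hdi' : ContinuousOn (fun t => alternatizeUncurryFinCLM ℝ X F
      (partialFst (hIntegrand α) (x, t))) (uIcc 0 1) :=
    (alternatizeUncurryFinCLM ℝ X F).continuous.comp_continuousOn hdi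
  calc extDeriv (fun x => ∫ t in (0 : ℝ)..1, hIntegrand α (x, t)) x +
        ∫ t in (0 : ℝ)..1, hIntegrand (extDeriv α) (x, t)
    _ = ∫ t in (0 : ℝ)..1, (alternatizeUncurryFinCLM ℝ X F (partialFst (hIntegrand α) (x, t)) +
          hIntegrand (extDeriv α) (x, t)) := by
      rw [extDeriv, (hasFDerivAt_integral_of_contDiffOn hV hi hx).fderiv,
        ← alternatizeUncurryFinCLM_apply,
        ← ContinuousLinearMap.intervalIntegral_comp_comm _ hdi.intervalIntegrable,
        ← intervalIntegral.integral_add hdi'.intervalIntegrable hid.intervalIntegrable]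
    _ = (1 : ℝ) ^ (k + 1) • α ((1 : ℝ) • x) - (0 : ℝ) ^ (k + 1) • α ((0 : ℝ) • x) :=
      intervalIntegral.integral_eq_sub_of_hasDerivAt
        (fun t ht => hasDerivAt_pow_smul_comp_smul hO (hα.of_le (by simp)) (hx t ht))
        (hdi'.add hid).intervalIntegrable
    _ = α x := by simp

end HomotopyFormula

section HomotopyOperator

variable {n k : ℕ} {F : Type*} [NormedAddCommGroup F] [NormedSpace ℝ F] {O : Set (E n)}

theorem smul_mem_of_starConvex {X : Type*} [AddCommGroup X] [Module ℝ X] {s : Set X}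
    (hs : StarConvex ℝ 0 s) {x : X} (hx : x ∈ s) : ∀ t ∈ uIcc (0 : ℝ) 1, t • x ∈ s := fun t ht => by
  rw [uIcc_of_le zero_le_one] at ht
  exact starConvex_zero_iff.1 hs hx ht.1 ht.2

theorem contDiffOn_hOp {α : E n → E n [⋀^Fin (k + 1)]→L[ℝ] F} (hO : IsOpen O)
    (hstar : StarConvex ℝ 0 O) (hα : ContDiffOn ℝ ∞ α O) : ContDiffOn ℝ ∞ (hOp α) O :=
  contDiffOn_integral hO (isOpen_setOf_smul_mem hO) (fun _ hx => smul_mem_of_starConvex hstar hx)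
    (contDiffOn_hIntegrand hα)

theorem extDeriv_hOp_add [CompleteSpace F] {α : E n → E n [⋀^Fin (k + 1)]→L[ℝ] F} (hO : IsOpen O)
    (hstar : StarConvex ℝ 0 O) (hα : ContDiffOn ℝ ∞ α O) {x : E n} (hx : x ∈ O) :
    extDeriv (hOp α) x + hOp (extDeriv α) x = α x :=
  extDeriv_integral_hIntegrand_add hO hα (smul_mem_of_starConvex hstar hx)

end HomotopyOperator

section ExteriorForms

open ContinuousAlternatingMap

variable {n k : ℕ}

theorem toForm_coe (a : ⋀[ℝ]^k (Module.Dual ℝ (E n))) :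
    toForm n k (a : Lam n) = formEquiv n k a := by
  simp only [toForm, LinearMap.comp_apply, LinearEquiv.coe_coe,
    DirectSum.decomposeLinearEquiv_apply, DirectSum.decompose_coe]
  rw [← DirectSum.apply_eq_component, DirectSum.of_eq_same]

theorem toForm_coe_of_ne {m : ℕ} (hmk : m ≠ k) (a : ⋀[ℝ]^m (Module.Dual ℝ (E n))) :
    toForm n k (a : Lam n) = 0 := by
  simp only [toForm, LinearMap.comp_apply, LinearEquiv.coe_coe,
    DirectSum.decomposeLinearEquiv_apply, DirectSum.decompose_coe]
  rw [← DirectSum.apply_eq_component, DirectSum.of_eq_of_ne _ _ _ hmk.symm, _root_.map_zero]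

theorem toForm_ιMulti (φ : Fin k → Module.Dual ℝ (E n)) (v : Fin k → E n) :
    toForm n k (ExteriorAlgebra.ιMulti ℝ k φ) v = (Matrix.of fun i j => φ j (v i)).det := by
  rw [← exteriorPower.ιMulti_apply_coe, toForm_coe]
  exact toAlt_ιMulti φ v

theorem toForm_ιMulti_of_ne {m : ℕ} (hmk : m ≠ k) (φ : Fin m → Module.Dual ℝ (E n)) :
    toForm n k (ExteriorAlgebra.ιMulti ℝ m φ) = 0 := by
  rw [← exteriorPower.ιMulti_apply_coe, toForm_coe_of_ne hmk]

theorem toForm_ι_mul_ιMulti (φ : Module.Dual ℝ (E n)) {m : ℕ} (ψ : Fin m → Module.Dual ℝ (E n)) :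
    toForm n (k + 1) (ExteriorAlgebra.ι ℝ φ * ExteriorAlgebra.ιMulti ℝ m ψ) =
      alternatizeUncurryFin (ContinuousLinearMap.smulRight (LinearMap.toContinuousLinearMap φ)
        (toForm n k (ExteriorAlgebra.ιMulti ℝ m ψ))) := by
  have hcons : ExteriorAlgebra.ι ℝ φ * ExteriorAlgebra.ιMulti ℝ m ψ =
      ExteriorAlgebra.ιMulti ℝ (m + 1) (Matrix.vecCons φ ψ) := by
    rw [ExteriorAlgebra.ιMulti_succ_apply]
    rfl
  rw [hcons]
  ext v
  rcases eq_or_ne m k with rfl | hmk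
  · rw [toForm_ιMulti, Matrix.det_succ_column_zero, alternatizeUncurryFin_apply]
    refine Finset.sum_congr rfl fun j _ => ?_
    simp only [ContinuousLinearMap.smulRight_apply, ContinuousAlternatingMap.smul_apply,
      toForm_ιMulti, Matrix.of_apply, Matrix.cons_val_zero, smul_eq_mul, zsmul_eq_mul]
    push_cast
    rw [mul_assoc]
    rfl
  · rw [toForm_ιMulti_of_ne hmk, toForm_ιMulti_of_ne (by omega)]
    simp [alternatizeUncurryFin_apply]

theorem toForm_ι_mul (φ : Module.Dual ℝ (E n)) (a : Lam n) :
    toForm n (k + 1) (ExteriorAlgebra.ι ℝ φ * a) =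
      alternatizeUncurryFin (ContinuousLinearMap.smulRight (LinearMap.toContinuousLinearMap φ)
        (toForm n k a)) := by
  suffices toForm n (k + 1) ∘ₗ LinearMap.mulLeft ℝ (ExteriorAlgebra.ι ℝ φ) =
      (alternatizeUncurryFinCLM ℝ (E n) ℝ).toLinearMap ∘ₗ (ContinuousLinearMap.smulRightL ℝ (E n) _
        (LinearMap.toContinuousLinearMap φ)).toLinearMap ∘ₗ toForm n k from
    LinearMap.congr_fun this a
  exact LinearMap.ext_on_range (ExteriorAlgebra.ιMulti_span ℝ _)
    fun ψ => toForm_ι_mul_ιMulti φ ψ.2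

instance finiteDimensional_alternating : FiniteDimensional ℝ (E n [⋀^Fin k]→L[ℝ] ℝ) :=
  LinearEquiv.finiteDimensional (formEquiv n k)

/-- The inclusion `Altᵏ(ℝⁿ) → ⋀ (ℝⁿ)*`, a right inverse of `toForm`. -/
def ofForm : (E n [⋀^Fin k]→L[ℝ] ℝ) →ₗ[ℝ] Lam n :=
  (⋀[ℝ]^k (Module.Dual ℝ (E n))).subtype ∘ₗ (formEquiv n k).symm.toLinearMap

theorem ofForm_mem (β : E n [⋀^Fin k]→L[ℝ] ℝ) : ofForm β ∈ ⋀[ℝ]^k (Module.Dual ℝ (E n)) :=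
  Subtype.mem _

theorem toForm_ofForm (β : E n [⋀^Fin k]→L[ℝ] ℝ) : toForm n k (ofForm β) = β :=
  (toForm_coe _).trans (LinearEquiv.apply_symm_apply _ β)

theorem ofForm_toForm {a : Lam n} (ha : a ∈ ⋀[ℝ]^k (Module.Dual ℝ (E n))) :
    ofForm (toForm n k a) = a :=
  congrArg Subtype.val <|
    (congrArg (formEquiv n k).symm (toForm_coe ⟨a, ha⟩)).trans (LinearEquiv.symm_apply_apply _ _)

theorem toForm_algebraMap (r : ℝ) (v : Fin 0 → E n) :
    toForm n 0 (algebraMap ℝ (Lam n) r) v = r := by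
  have hone := toForm_ιMulti (n := n) ![] v
  rw [ExteriorAlgebra.ιMulti_zero_apply] at hone
  simp [Algebra.algebraMap_eq_smul_one, hone]

theorem algebraMap_mem (r : ℝ) : algebraMap ℝ (Lam n) r ∈ ⋀[ℝ]^0 (Module.Dual ℝ (E n)) :=
  SetLike.algebraMap_mem_graded (fun k : ℕ => ⋀[ℝ]^k (Module.Dual ℝ (E n))) r

end ExteriorForms

section FiniteDimensionality

variable {V : Type*} [AddCommGroup V] [Module ℝ V] [FiniteDimensional ℝ V]

theorem exteriorPower_eq_bot {k : ℕ} (hk : Module.finrank ℝ V < k) : ⋀[ℝ]^k V = ⊥ := by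
  rw [← Submodule.finrank_eq_zero (R := ℝ), exteriorPower.finrank_eq,
    Nat.choose_eq_zero_of_lt hk]

instance finiteDimensional_exteriorAlgebra : FiniteDimensional ℝ (ExteriorAlgebra ℝ V) := by
  have htop : (Finset.range (Module.finrank ℝ V + 1)).sup (fun k => ⋀[ℝ]^k V) = ⊤ := by
    rw [eq_top_iff, ← (DirectSum.Decomposition.isInternal
      fun k : ℕ => ⋀[ℝ]^k V).submodule_iSup_eq_top]
    refine iSup_le fun k => ?_
    rcases lt_or_ge (Module.finrank ℝ V) k with hk | hk
    · exact (exteriorPower_eq_bot hk).trans_le bot_le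
    · exact Finset.le_sup (f := fun k => ⋀[ℝ]^k V) (Finset.mem_range_succ_iff.2 hk)
  have hfinite := Submodule.finiteDimensional_finset_sup (Finset.range (Module.finrank ℝ V + 1))
    fun k => ⋀[ℝ]^k V
  rw [htop] at hfinite
  exact Module.finite_def.2 ((Submodule.fg_top _).1 hfinite.fg_top)

end FiniteDimensionality

section ExteriorCalculus

open ContinuousAlternatingMap

variable {n k : ℕ}

/-- The norm on `⋀ (ℝⁿ)*` given by the coordinates in a basis; all norms on this space are
equivalent. -/
instance normedAddCommGroupLam : NormedAddCommGroup (Lam n) :=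
  NormedAddCommGroup.induced (Lam n) (Fin _ → ℝ) (Module.finBasis ℝ (Lam n)).equivFun
    (Module.finBasis ℝ (Lam n)).equivFun.injective

instance normedSpaceLam : NormedSpace ℝ (Lam n) :=
  NormedSpace.induced ℝ (Lam n) (Fin _ → ℝ) (Module.finBasis ℝ (Lam n)).equivFun

/-- The wedge product of `⋀ (ℝⁿ)*` as a continuous bilinear map. -/
def mulCLM (n : ℕ) : Lam n →L[ℝ] Lam n →L[ℝ] Lam n :=
  LinearMap.toContinuousLinearMap
    (LinearMap.toContinuousLinearMap.toLinearMap ∘ₗ LinearMap.mul ℝ (Lam n))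

theorem mulCLM_apply (a b : Lam n) : mulCLM n a b = a * b := rfl

/-- The covector `dxᵢ`. -/
def dx (i : Fin n) : Lam n := ExteriorAlgebra.ι ℝ ((stdBasis n).coord i)

theorem dx_mem (i : Fin n) : dx i ∈ ⋀[ℝ]^1 (Module.Dual ℝ (E n)) :=
  (pow_one (LinearMap.range _)).ge ⟨_, rfl⟩

theorem dx_mul (i : Fin n) {a : Lam n} (ha : a ∈ ⋀[ℝ]^k (Module.Dual ℝ (E n))) :
    dx i * a = (-1 : ℝ) ^ k • (a * dx i) := by
  simpa only [one_mul] using graded_comm (dx_mem i) ha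

/-- The exterior derivative of a differential form given as a function with values in
`⋀ (ℝⁿ)*`. -/
def dLam (θ : E n → Lam n) (x : E n) : Lam n :=
  ∑ i, dx i * fderiv ℝ θ x (stdBasis n i)

variable {θ η : E n → Lam n} {x : E n}

theorem dLam_mul (hθ : DifferentiableAt ℝ θ x) (hη : DifferentiableAt ℝ η x)
    (hk : θ x ∈ ⋀[ℝ]^k (Module.Dual ℝ (E n))) :
    dLam (fun y => θ y * η y) x = dLam θ x * η x + (-1 : ℝ) ^ k • (θ x * dLam η x) := by
  have hmul : HasFDerivAt (fun y => θ y * η y) _ x :=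
    (mulCLM n).hasFDerivAt_of_bilinear hθ.hasFDerivAt hη.hasFDerivAt
  simp only [dLam, hmul.fderiv, Finset.sum_mul, Finset.mul_sum, Finset.smul_sum,
    ← Finset.sum_add_distrib]
  refine Finset.sum_congr rfl fun i _ => ?_
  have hcomm : dx i * (θ x * fderiv ℝ η x (stdBasis n i)) =
      (-1 : ℝ) ^ k • (θ x * (dx i * fderiv ℝ η x (stdBasis n i))) := by
    rw [← mul_assoc, dx_mul i hk, smul_mul_assoc, mul_assoc]
  simp only [_root_.add_apply, ContinuousLinearMap.precompR_apply,
    ContinuousLinearMap.precompL_apply, ContinuousLinearMap.compL_apply,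
    ContinuousLinearMap.comp_apply, mulCLM_apply, mul_add]
  rw [hcomm, mul_assoc, add_comm]

theorem dLam_add (hθ : DifferentiableAt ℝ θ x) (hη : DifferentiableAt ℝ η x) :
    dLam (fun y => θ y + η y) x = dLam θ x + dLam η x := by
  simp [dLam, fderiv_fun_add hθ hη, mul_add, Finset.sum_add_distrib]

theorem dLam_smul (c : ℝ) (hθ : DifferentiableAt ℝ θ x) :
    dLam (fun y => c • θ y) x = c • dLam θ x := by
  simp [dLam, fderiv_fun_const_smul hθ, Finset.smul_sum]

theorem dLam_congr (h : θ =ᶠ[𝓝 x] η) : dLam θ x = dLam η x := by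
  simp only [dLam, h.fderiv_eq]

theorem toForm_dLam (hθ : DifferentiableAt ℝ θ x) :
    toForm n (k + 1) (dLam θ x) = extDeriv (fun y => toForm n k (θ y)) x := by
  have hfderiv : fderiv ℝ (fun y => toForm n k (θ y)) x =
      (LinearMap.toContinuousLinearMap (toForm n k)).comp (fderiv ℝ θ x) :=
    (HasFDerivAt.comp x (g := LinearMap.toContinuousLinearMap (toForm n k))
      (ContinuousLinearMap.hasFDerivAt _) hθ.hasFDerivAt).fderiv
  rw [extDeriv, hfderiv, dLam, _root_.map_sum]
  simp only [dx, toForm_ι_mul, ← alternatizeUncurryFinCLM_apply]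
  rw [← _root_.map_sum]
  congr 1
  ext v w
  conv_rhs => rw [← (stdBasis n).sum_repr v, _root_.map_sum]
  simp

theorem dLam_ofForm {α : E n → E n [⋀^Fin k]→L[ℝ] ℝ} (hα : DifferentiableAt ℝ α x) :
    dLam (fun y => ofForm (α y)) x = ofForm (extDeriv α x) := by
  have hfderiv : HasFDerivAt (fun y => ofForm (α y))
      ((LinearMap.toContinuousLinearMap ofForm).comp (fderiv ℝ α x)) x :=
    HasFDerivAt.comp x (g := LinearMap.toContinuousLinearMap ofForm)
      (ContinuousLinearMap.hasFDerivAt _) hα.hasFDerivAt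
  have hmem : dLam (fun y => ofForm (α y)) x ∈ ⋀[ℝ]^(k + 1) (Module.Dual ℝ (E n)) := by
    rw [dLam, hfderiv.fderiv, add_comm k 1]
    exact Submodule.sum_mem _ fun i _ => SetLike.mul_mem_graded
      (A := fun k : ℕ => ⋀[ℝ]^k (Module.Dual ℝ (E n))) (dx_mem i) (ofForm_mem _)
  rw [← ofForm_toForm hmem, toForm_dLam hfderiv.differentiableAt]
  simp only [toForm_ofForm]

end ExteriorCalculus

section Postcomp

variable {X F G : Type*} [NormedAddCommGroup X] [NormedSpace ℝ X] [NormedAddCommGroup F]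
  [NormedSpace ℝ F] [NormedAddCommGroup G] [NormedSpace ℝ G] {k : ℕ}

/-- Composition of the values of an alternating form with a continuous linear map, as a continuous
linear map between spaces of alternating forms. -/
def postcomp (g : F →L[ℝ] G) : (X [⋀^Fin k]→L[ℝ] F) →L[ℝ] X [⋀^Fin k]→L[ℝ] G :=
  ContinuousLinearMap.compContinuousAlternatingMapCLM ℝ X F G (Fin k) g

theorem postcomp_apply (g : F →L[ℝ] G) (β : X [⋀^Fin k]→L[ℝ] F) :
    postcomp g β = g.compContinuousAlternatingMap β := rfl

theorem extDeriv_postcomp (g : F →L[ℝ] G) {α : X → X [⋀^Fin k]→L[ℝ] F} {x : X}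
    (hα : DifferentiableAt ℝ α x) :
    extDeriv (fun y => postcomp g (α y)) x = postcomp g (extDeriv α x) := by
  have hfderiv : HasFDerivAt (fun y => postcomp g (α y)) ((postcomp g).comp (fderiv ℝ α x)) x :=
    (postcomp g).hasFDerivAt.comp x hα.hasFDerivAt
  rw [extDeriv, extDeriv, hfderiv.fderiv]
  ext v
  simp [postcomp_apply, ContinuousAlternatingMap.alternatizeUncurryFin_apply]

variable [FiniteDimensional ℝ F]

theorem sum_postcomp_coord (β : X [⋀^Fin k]→L[ℝ] F) :
    ∑ i, postcomp (ContinuousLinearMap.toSpanSingleton ℝ (Module.finBasis ℝ F i))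
      (postcomp (LinearMap.toContinuousLinearMap ((Module.finBasis ℝ F).coord i)) β) = β := by
  ext v
  simp [postcomp_apply]

theorem contDiffOn_of_postcomp {Y : Type*} [NormedAddCommGroup Y] [NormedSpace ℝ Y]
    {f : Y → X [⋀^Fin k]→L[ℝ] F} {s : Set Y} {m : ℕ∞ω}
    (hf : ∀ ξ : StrongDual ℝ F, ContDiffOn ℝ m (fun y => postcomp ξ (f y)) s) :
    ContDiffOn ℝ m f s := by
  have hsum := ContDiffOn.sum (s := Finset.univ) fun i _ =>
    (postcomp (ContinuousLinearMap.toSpanSingleton ℝ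
      (Module.finBasis ℝ F i))).contDiff.comp_contDiffOn
        (hf (LinearMap.toContinuousLinearMap ((Module.finBasis ℝ F).coord i)))
  exact hsum.congr fun y _ => (sum_postcomp_coord (f y)).symm

theorem isBigO_of_postcomp {Y : Type*} {f : Y → X [⋀^Fin k]→L[ℝ] F} {c : Y → ℝ}
    {l : Filter Y} (hf : ∀ ξ : StrongDual ℝ F, (fun y => postcomp ξ (f y)) =O[l] c) :
    f =O[l] c := by
  have hsum := Asymptotics.IsBigO.sum (s := Finset.univ) fun i _ =>
    ((postcomp (X := X) (k := k) (ContinuousLinearMap.toSpanSingleton ℝ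
      (Module.finBasis ℝ F i))).isBigO_comp _ l).trans
        (hf (LinearMap.toContinuousLinearMap ((Module.finBasis ℝ F).coord i)))
  exact hsum.congr_left fun y => (Finset.sum_apply y _ _).trans (sum_postcomp_coord (f y))

end Postcomp

section PointDerivation

open Metric

universe u

variable {Y : Type u} [NormedAddCommGroup Y] [NormedSpace ℝ Y]

theorem intervalIntegral_fderiv_apply_sub [CompleteSpace Y] {F : Y → ℝ} {s : Set Y} {u y : Y}
    (hs : IsOpen s) (hF : ContDiffOn ℝ 1 F s) (hseg : ∀ t ∈ Icc (0 : ℝ) 1, u + t • (y - u) ∈ s) :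
    (∫ t in (0 : ℝ)..1, fderiv ℝ F (u + t • (y - u))) (y - u) = F y - F u := by
  have hcont : ContinuousOn (fun t : ℝ => fderiv ℝ F (u + t • (y - u))) (Icc 0 1) :=
    (hF.continuousOn_fderiv_of_isOpen hs le_rfl).comp (by fun_prop) hseg
  have hderiv : ∀ t ∈ uIcc (0 : ℝ) 1, HasDerivAt (fun t : ℝ => F (u + t • (y - u)))
      (fderiv ℝ F (u + t • (y - u)) (y - u)) t := by
    intro t ht
    rw [uIcc_of_le zero_le_one] at ht
    have hline : HasDerivAt (fun t : ℝ => u + t • (y - u)) (y - u) t := by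
      simpa using ((hasDerivAt_id t).smul_const (y - u)).const_add u
    exact ((hF.differentiableOn one_ne_zero).differentiableAt
      (hs.mem_nhds (hseg t ht))).hasFDerivAt.comp_hasDerivAt t hline
  rw [ContinuousLinearMap.intervalIntegral_apply (hcont.intervalIntegrable_of_Icc zero_le_one),
    intervalIntegral.integral_eq_sub_of_hasDerivAt hderiv
      ((hcont.clm_apply continuousOn_const).intervalIntegrable_of_Icc zero_le_one)]
  simp

theorem exists_contDiffOn_eq_add_apply_sub [CompleteSpace Y] {F : Y → ℝ} {u : Y} {r : ℝ}
    (hF : ContDiffOn ℝ ∞ F (ball u r)) :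
    ∃ G : Y → StrongDual ℝ Y, ContDiffOn ℝ ∞ G (ball u r) ∧ G u = fderiv ℝ F u ∧
      ∀ y ∈ ball u r, F y = F u + G y (y - u) := by
  have hseg : ∀ y ∈ ball u r, ∀ t ∈ Icc (0 : ℝ) 1, u + t • (y - u) ∈ ball u r := fun y hy t ht =>
    (convex_ball u r).add_smul_sub_mem (mem_ball_self (pos_of_mem_ball hy)) hy ht
  have hline : ContDiff ℝ ∞ fun p : Y × ℝ => u + p.2 • (p.1 - u) := by fun_prop
  have hsmooth : ContDiffOn ℝ ∞ (fun p : Y × ℝ => fderiv ℝ F (u + p.2 • (p.1 - u)))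
      {p | u + p.2 • (p.1 - u) ∈ ball u r} :=
    (hF.fderiv_of_isOpen isOpen_ball (by simp)).comp hline.contDiffOn fun _ => id
  refine ⟨fun y => ∫ t in (0 : ℝ)..1, fderiv ℝ F (u + t • (y - u)),
    contDiffOn_integral.{u, u} isOpen_ball (isOpen_ball.preimage hline.continuous)
      (by rwa [uIcc_of_le zero_le_one]) hsmooth, by simp, fun y hy => ?_⟩
  rw [intervalIntegral_fderiv_apply_sub isOpen_ball (hF.of_le (by simp)) (hseg y hy),
    add_sub_cancel]

variable {U : Opens Y}

/-- The extension by zero of a smooth function on `U`. -/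
def extendZero (f : C^∞⟮𝓘(ℝ, Y), U; 𝓘(ℝ, ℝ), ℝ⟯) : Y → ℝ :=
  Function.extend Subtype.val f 0

theorem extendZero_of_mem (f : C^∞⟮𝓘(ℝ, Y), U; 𝓘(ℝ, ℝ), ℝ⟯) {y : Y} (hy : y ∈ U) :
    extendZero f y = f ⟨y, hy⟩ :=
  Subtype.val_injective.extend_apply f 0 ⟨y, hy⟩

theorem contDiffOn_extendZero (f : C^∞⟮𝓘(ℝ, Y), U; 𝓘(ℝ, ℝ), ℝ⟯) :
    ContDiffOn ℝ ∞ (extendZero f) U := by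
  intro y hy
  have hcomp : extendZero f ∘ Subtype.val = f :=
    funext fun x => extendZero_of_mem f x.2
  have hmdiff : ContMDiffAt 𝓘(ℝ, Y) 𝓘(ℝ, ℝ) ∞ (fun x : U => extendZero f x) ⟨y, hy⟩ :=
    (congrArg (fun g => ContMDiffAt _ _ _ g _) hcomp).mpr (f.contMDiff _)
  exact (contMDiffAt_iff_contDiffAt.1 (contMDiffAt_subtype_iff.1 hmdiff)).contDiffWithinAt

/-- The restriction to `U` of a function that is smooth there. -/
def restrictSmooth (F : Y → ℝ) (hF : ContDiffOn ℝ ∞ F U) : C^∞⟮𝓘(ℝ, Y), U; 𝓘(ℝ, ℝ), ℝ⟯ :=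
  ⟨fun x => F x, fun x => contMDiffAt_subtype_iff.2
    (contMDiffAt_iff_contDiffAt.2 ((hF x x.2).contDiffAt (U.isOpen.mem_nhds x.2)))⟩

theorem contDiff_bump_mul [FiniteDimensional ℝ Y] {u : Y} (χ : ContDiffBump u) {r : ℝ}
    (hr : χ.rOut < r) {g : Y → ℝ} (hg : ContDiffOn ℝ ∞ g (ball u r)) :
    ContDiff ℝ ∞ fun y => χ y * g y := by
  rw [contDiff_iff_contDiffAt]
  intro y
  rcases em (y ∈ ball u r) with hy | hy
  · exact χ.contDiffAt.mul (hg.contDiffAt (isOpen_ball.mem_nhds hy))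
  · have hy' : y ∈ (closedBall u χ.rOut)ᶜ := fun hmem => hy (lt_of_le_of_lt hmem hr)
    refine contDiffAt_const (c := (0 : ℝ)) |>.congr_of_eventuallyEq ?_
    filter_upwards [isClosed_closedBall.isOpen_compl.mem_nhds hy'] with z hz
    rw [χ.zero_of_le_dist (not_le.1 (notMem_of_mem_compl hz)).le, zero_mul]

variable [FiniteDimensional ℝ Y] {u : U}

/-- A bump function turns the local factorization of Hadamard's lemma into one on all of `U`. -/
theorem exists_mul_mul_eq_sum_mul {f : C^∞⟮𝓘(ℝ, Y), U; 𝓘(ℝ, ℝ), ℝ⟯} (hf : f u = 0)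
    (hdf : fderiv ℝ (extendZero f) u = 0) :
    ∃ (e : C^∞⟮𝓘(ℝ, Y), U; 𝓘(ℝ, ℝ), ℝ⟯)
      (c d : Fin (Module.finrank ℝ Y) → C^∞⟮𝓘(ℝ, Y), U; 𝓘(ℝ, ℝ), ℝ⟯),
      e u = 1 ∧ (∀ j, c j u = 0) ∧ (∀ j, d j u = 0) ∧ e * e * f = ∑ j, c j * d j := by
  have : CompleteSpace Y := FiniteDimensional.complete ℝ Y
  obtain ⟨r, hr, hrU⟩ := Metric.isOpen_iff.1 U.isOpen u u.2
  obtain ⟨G, hG, hGu, hfG⟩ :=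
    exists_contDiffOn_eq_add_apply_sub ((contDiffOn_extendZero f).mono hrU)
  let χ : ContDiffBump (u : Y) := ⟨r / 4, r / 2, by linarith, by linarith⟩
  have hχr : χ.rOut < r := half_lt_self hr
  let b := Module.finBasis ℝ Y
  refine ⟨restrictSmooth χ χ.contDiff.contDiffOn,
    fun j => restrictSmooth (fun y => χ y * LinearMap.toContinuousLinearMap (b.coord j) (y - u))
      (contDiff_bump_mul χ hχr (by fun_prop)).contDiffOn,
    fun j => restrictSmooth (fun y => χ y * G y (b j))
      (contDiff_bump_mul χ hχr (hG.clm_apply contDiffOn_const)).contDiffOn,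
    χ.one_of_mem_closedBall (mem_closedBall_self χ.rIn_pos.le), fun j => ?_, fun j => ?_, ?_⟩
  · simp [restrictSmooth]
  · change χ u * G u (b j) = 0
    rw [hGu, hdf, zero_apply, mul_zero]
  ext y
  rw [← ContMDiffMap.coeFnAlgHom_apply (𝕜 := ℝ) (∑ j, _), map_sum, Finset.sum_apply]
  change χ y * χ y * f y = ∑ j, (χ y * b.coord j (y - u)) * (χ y * G y (b j))
  rcases em ((y : Y) ∈ ball (u : Y) r) with hy | hy
  · have hfy : f y = G y (y - u) := by
      simpa [extendZero_of_mem, hf] using hfG y hy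
    conv_lhs => rw [hfy, ← b.sum_repr (y - u), map_sum, Finset.mul_sum]
    refine Finset.sum_congr rfl fun j _ => ?_
    rw [map_smul, smul_eq_mul, b.coord_apply]
    ring
  · simp [χ.zero_of_le_dist (hχr.le.trans (not_lt.1 hy))]

variable {V : Type*} [AddCommGroup V] [Module ℝ V]
  {v : C^∞⟮𝓘(ℝ, Y), U; 𝓘(ℝ, ℝ), ℝ⟯ →ₗ[ℝ] V}

theorem pointDerivation_eq_zero (hv : ∀ f g, v (f * g) = f u • v g + g u • v f)
    {f : C^∞⟮𝓘(ℝ, Y), U; 𝓘(ℝ, ℝ), ℝ⟯} (hf : f u = 0) (hdf : fderiv ℝ (extendZero f) u = 0) :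
    v f = 0 := by
  obtain ⟨e, c, d, he, hc, hd, hfactor⟩ := exists_mul_mul_eq_sum_mul hf hdf
  have heu : (e * e) u = 1 := (congrArg₂ (· * ·) he he).trans (one_mul 1)
  calc v f = v (e * e * f) := by rw [hv, hf, heu, one_smul, zero_smul, add_zero]
    _ = ∑ j, v (c j * d j) := by rw [hfactor, map_sum]
    _ = 0 := Finset.sum_eq_zero fun j _ => by rw [hv, hc, hd, zero_smul, zero_smul, add_zero]

theorem pointDerivation_eq (hv : ∀ f g, v (f * g) = f u • v g + g u • v f)
    (f : C^∞⟮𝓘(ℝ, Y), U; 𝓘(ℝ, ℝ), ℝ⟯) :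
    v f = v (restrictSmooth (fderiv ℝ (extendZero f) u)
      (ContinuousLinearMap.contDiff _).contDiffOn) := by
  set ξ := fderiv ℝ (extendZero f) (u : Y)
  set l : C^∞⟮𝓘(ℝ, Y), U; 𝓘(ℝ, ℝ), ℝ⟯ := restrictSmooth ξ ξ.contDiff.contDiffOn
  have hone : v 1 = 0 := by simpa using hv 1 1
  have hderiv : HasFDerivAt (extendZero (f - l - (f u - ξ u) • 1)) (ξ - ξ) u := by
    have hf : HasFDerivAt (extendZero f) ξ u :=
      (((contDiffOn_extendZero f).differentiableOn (by simp)).differentiableAt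
        (U.isOpen.mem_nhds u.2)).hasFDerivAt
    refine ((hf.sub ξ.hasFDerivAt).sub_const ((f u - ξ u) • (1 : ℝ))).congr_of_eventuallyEq ?_
    filter_upwards [U.isOpen.mem_nhds u.2] with y hy
    rw [extendZero_of_mem _ hy, Pi.sub_apply, extendZero_of_mem _ hy]
    rfl
  have hzero : v (f - l - (f u - ξ u) • 1) = 0 := by
    refine pointDerivation_eq_zero hv ?_ (hderiv.fderiv.trans (sub_self ξ))
    change f u - ξ u - (f u - ξ u) • (1 : ℝ) = 0
    simp
  rwa [map_sub, map_sub, map_smul, hone, smul_zero, sub_zero, sub_eq_zero] at hzero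

end PointDerivation

section Evaluation

variable {W : ℕ → Type*} [∀ k, NormedAddCommGroup (W k)] [∀ k, NormedSpace ℝ (W k)] {n : ℕ}
  {U : Opens (W 0)}

theorem evalSym_sgen (a : ∀ k, E n [⋀^Fin k]→L[ℝ] W k) (k : ℕ) (ξ : StrongDual ℝ (W (k + 1))) :
    evalSym a (sgen W k ξ) = ofForm (postcomp ξ (a (k + 1))) := by
  simp only [evalSym, sgen, LinearMap.comp_apply, AlgHom.toLinearMap_apply]
  rw [RingQuot.liftAlgHom_mkAlgHom_apply, TensorAlgebra.lift_ι_apply, DirectSum.toModule_lof]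
  rfl

@[elab_as_elim]
theorem gradedSym_induction {motive : GradedSym W → Prop}
    (algebraMap : ∀ r : ℝ, motive (algebraMap ℝ _ r)) (sgen : ∀ k ξ, motive (sgen W k ξ))
    (add : ∀ a b, motive a → motive b → motive (a + b))
    (mul : ∀ a b, motive a → motive b → motive (a * b)) (s : GradedSym W) : motive s := by
  obtain ⟨s, rfl⟩ := RingQuot.mkAlgHom_surjective ℝ (SymRel W) s
  induction s using TensorAlgebra.induction with
  | algebraMap r => rw [AlgHom.commutes]; exact algebraMap r
  | ι m =>
    induction m using DirectSum.induction_on with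
    | zero => simpa using algebraMap 0
    | of k ξ => exact sgen k ξ
    | add a b ha hb => rw [map_add, map_add]; exact add _ _ ha hb
  | mul a b ha hb => rw [map_mul]; exact mul _ _ ha hb
  | add a b ha hb => rw [map_add]; exact add _ _ ha hb

open Classical in
/-- The substitution `F ↦ F(A)` at the point `x`, with value zero where the `0`-form part of `A` is
not in `U`. -/
def evalAt (U : Opens (W 0)) (A : Form0 n W) (x : E n) : Alg U →ₗ[ℝ] Lam n :=
  if hx : A 0 x ![] ∈ U then (evalAlg U (fun k => A k x) hx).toLinearMap else 0

variable {A : Form0 n W} {x : E n}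

theorem evalAt_of_mem (hx : A 0 x ![] ∈ U) (F : Alg U) :
    evalAt U A x F = evalAlg U (fun k => A k x) hx F := by
  rw [evalAt, dif_pos hx]
  rfl

theorem evalAt_tmul (hx : A 0 x ![] ∈ U) (f : Smooth U) (s : GradedSym W) :
    evalAt U A x (f ⊗ₜ s) = extendZero f (A 0 x ![]) • evalSym (fun k => A k x) s := by
  rw [evalAt_of_mem hx, evalAlg, Algebra.TensorProduct.lift_tmul, Algebra.smul_def,
    extendZero_of_mem f hx]
  rfl

theorem evalAt_mul (hx : A 0 x ![] ∈ U) (F G : Alg U) :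
    evalAt U A x (F * G) = evalAt U A x F * evalAt U A x G := by
  simp only [evalAt_of_mem hx, map_mul]

theorem evalAt_coordFn (hx : A 0 x ![] ∈ U) (k : ℕ) (ξ : StrongDual ℝ (W k)) :
    evalAt U A x (coordFn U k ξ) = ofForm (postcomp ξ (A k x)) := by
  cases k with
  | zero =>
    change evalAt U A x (linSmooth U ξ ⊗ₜ 1) = _
    rw [evalAt_tmul hx, map_one, ← Algebra.algebraMap_eq_smul_one,
      ← ofForm_toForm (algebraMap_mem _)]
    congr 1
    ext v
    rw [toForm_algebraMap, extendZero_of_mem _ hx, Subsingleton.elim v ![]]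
    rfl
  | succ k =>
    change evalAt U A x ((1 : Smooth U) ⊗ₜ sgen W k ξ) = _
    rw [evalAt_tmul hx, evalSym_sgen, extendZero_of_mem _ hx]
    exact one_smul _ _

theorem evalSym_mem (a : ∀ k, E n [⋀^Fin k]→L[ℝ] W k) {m : ℕ} {s : GradedSym W}
    (hs : s ∈ symDeg W m) : evalSym a s ∈ ⋀[ℝ]^m (Module.Dual ℝ (E n)) := by
  suffices symDeg W m ≤ (⋀[ℝ]^m (Module.Dual ℝ (E n))).comap (evalSym a).toLinearMap from this hs
  refine Submodule.span_le.2 ?_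
  rintro _ ⟨L, rfl, rfl⟩
  rw [SetLike.mem_coe, Submodule.mem_comap, AlgHom.toLinearMap_apply, map_list_prod, List.map_map]
  refine SetLike.list_prod_map_mem_graded (A := fun k : ℕ => ⋀[ℝ]^k (Module.Dual ℝ (E n)))
    L _ _ fun p _ => ?_
  rw [Function.comp_apply, evalSym_sgen]
  exact ofForm_mem _

theorem evalAt_mem (hx : A 0 x ![] ∈ U) {m : ℕ} {F : Alg U} (hF : F ∈ algDeg U m) :
    evalAt U A x F ∈ ⋀[ℝ]^m (Module.Dual ℝ (E n)) := by
  suffices algDeg U m ≤ (⋀[ℝ]^m (Module.Dual ℝ (E n))).comap (evalAt U A x) from this hF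
  refine Submodule.span_le.2 ?_
  rintro _ ⟨f, s, hs, rfl⟩
  rw [SetLike.mem_coe, Submodule.mem_comap, evalAt_tmul hx]
  exact Submodule.smul_mem _ _ (evalSym_mem _ hs)

theorem tmul_one_mem_algDeg (f : Smooth U) : f ⊗ₜ[ℝ] (1 : GradedSym W) ∈ algDeg U 0 :=
  Submodule.subset_span ⟨f, 1, Submodule.subset_span ⟨[], rfl, rfl⟩, rfl⟩

theorem coordFn_mem_algDeg (k : ℕ) (ξ : StrongDual ℝ (W k)) : coordFn U k ξ ∈ algDeg U k := by
  cases k with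
  | zero => exact tmul_one_mem_algDeg _
  | succ k =>
    exact Submodule.subset_span ⟨1, sgen W k ξ, Submodule.subset_span
      ⟨[⟨k, ξ⟩], by simp, by simp⟩, rfl⟩

theorem postcomp_FQ [∀ k, FiniteDimensional ℝ (W k)] (Q : Differential U) (hx : A 0 x ![] ∈ U)
    (k : ℕ) (ξ : StrongDual ℝ (W k)) :
    postcomp ξ (FQ Q A k x) = toForm n (k + 1) (evalAt U A x (Q.Q (coordFn U k ξ))) := by
  rw [postcomp_apply, pairing_FQ Q A k x hx, evalAt_of_mem hx]

end Evaluation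

section SmoothForms

variable {W : ℕ → Type*} [∀ k, NormedAddCommGroup (W k)] [∀ k, NormedSpace ℝ (W k)] {n : ℕ}

/-- `A` is an element of `Ω(O, W|_U)⁰` for an open subset `O` of `ℝⁿ`. -/
structure IsSmoothFormIn (O : Set (E n)) (U : Opens (W 0)) (A : Form0 n W) : Prop where
  isOpen : IsOpen O
  contDiffOn : ∀ k, ContDiffOn ℝ ∞ (A k) O
  mem : ∀ x ∈ O, A 0 x ![] ∈ U

variable {A : Form0 n W} {O : Set (E n)}

theorem contDiffOn_evalSym (hA : ∀ k, ContDiffOn ℝ ∞ (A k) O) (s : GradedSym W) :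
    ContDiffOn ℝ ∞ (fun x => evalSym (fun k => A k x) s) O := by
  induction s using gradedSym_induction with
  | algebraMap r => simpa only [AlgHom.commutes] using contDiffOn_const
  | sgen k ξ =>
    simp only [evalSym_sgen]
    let L : (E n [⋀^Fin (k + 1)]→L[ℝ] W (k + 1)) →L[ℝ] Lam n :=
      (LinearMap.toContinuousLinearMap ofForm).comp (postcomp ξ)
    exact L.contDiff.comp_contDiffOn (hA (k + 1))
  | add a b ha hb => simpa only [map_add] using ha.add hb
  | mul a b ha hb =>
    simp only [map_mul, ← mulCLM_apply]
    exact ((mulCLM n).contDiff.comp_contDiffOn ha).clm_apply hb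

theorem contDiffOn_zeroForm (hA : ContDiffOn ℝ ∞ (A 0) O) :
    ContDiffOn ℝ ∞ (fun x => A 0 x ![]) O :=
  (ContinuousAlternatingMap.apply ℝ (E n) (W 0) ![]).contDiff.comp_contDiffOn hA

variable {U : Opens (W 0)}

theorem IsSmoothFormIn.contDiffOn_evalAt (hA : IsSmoothFormIn O U A) (F : Alg U) :
    ContDiffOn ℝ ∞ (fun x => evalAt U A x F) O := by
  induction F using TensorProduct.induction_on with
  | zero => simpa only [map_zero] using contDiffOn_const
  | tmul f s =>
    have hf : ContDiffOn ℝ ∞ (fun x => extendZero f (A 0 x ![])) O :=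
      (contDiffOn_extendZero f).comp (contDiffOn_zeroForm (hA.contDiffOn 0)) hA.mem
    exact (hf.smul (contDiffOn_evalSym hA.contDiffOn s)).congr
      fun x hx => evalAt_tmul (hA.mem x hx) f s
  | add a b ha hb => simpa only [map_add] using ha.add hb

theorem IsSmoothFormIn.differentiableAt_evalAt (hA : IsSmoothFormIn O U A) {x : E n} (hx : x ∈ O)
    (F : Alg U) : DifferentiableAt ℝ (fun y => evalAt U A y F) x :=
  ((hA.contDiffOn_evalAt F).differentiableOn (by simp)).differentiableAt (hA.isOpen.mem_nhds hx)

theorem IsSmoothFormIn.contDiffOn_FQ [∀ k, FiniteDimensional ℝ (W k)] (hA : IsSmoothFormIn O U A)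
    (Q : Differential U) (k : ℕ) : ContDiffOn ℝ ∞ (FQ Q A k) O :=
  contDiffOn_of_postcomp fun ξ =>
    ((LinearMap.toContinuousLinearMap (toForm n (k + 1))).contDiff.comp_contDiffOn
      (hA.contDiffOn_evalAt (Q.Q (coordFn U k ξ)))).congr
        fun x hx => postcomp_FQ Q (hA.mem x hx) k ξ

end SmoothForms

section Defect

open Asymptotics

variable {W : ℕ → Type*} [∀ k, NormedAddCommGroup (W k)] [∀ k, NormedSpace ℝ (W k)] {n : ℕ}
  {U : Opens (W 0)}

/-- The failure `d(F(A)) - (QF)(A)` of substitution to intertwine the differentials. -/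
def defect (Q : Differential U) (A : Form0 n W) (x : E n) (F : Alg U) : Lam n :=
  dLam (fun y => evalAt U A y F) x - evalAt U A x (Q.Q F)

variable {A : Form0 n W} {O S : Set (E n)} {x : E n}

theorem defect_add (Q : Differential U) (hA : IsSmoothFormIn O U A) (hx : x ∈ O) (F G : Alg U) :
    defect Q A x (F + G) = defect Q A x F + defect Q A x G := by
  simp only [defect, map_add]
  rw [dLam_add (hA.differentiableAt_evalAt hx F) (hA.differentiableAt_evalAt hx G)]
  abel

theorem defect_smul (Q : Differential U) (hA : IsSmoothFormIn O U A) (hx : x ∈ O) (r : ℝ)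
    (F : Alg U) : defect Q A x (r • F) = r • defect Q A x F := by
  simp only [defect, map_smul]
  rw [dLam_smul r (hA.differentiableAt_evalAt hx F), smul_sub]

theorem defect_mul (Q : Differential U) (hA : IsSmoothFormIn O U A) (hx : x ∈ O) {m : ℕ}
    {F : Alg U} (hF : F ∈ algDeg U m) (G : Alg U) :
    defect Q A x (F * G) =
      defect Q A x F * evalAt U A x G + (-1 : ℝ) ^ m • (evalAt U A x F * defect Q A x G) := by
  have hFG : (fun y => evalAt U A y (F * G)) =ᶠ[𝓝 x] fun y => evalAt U A y F * evalAt U A y G := by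
    filter_upwards [hA.isOpen.mem_nhds hx] with y hy
    exact evalAt_mul (hA.mem y hy) F G
  have hxU := hA.mem x hx
  simp only [defect]
  rw [dLam_congr hFG, dLam_mul (hA.differentiableAt_evalAt hx F) (hA.differentiableAt_evalAt hx G)
    (evalAt_mem hxU hF), Q.leibniz m F G hF, map_add, map_smul, evalAt_mul hxU, evalAt_mul hxU,
    sub_mul, mul_sub, smul_sub]
  abel

/-- The defect `dA - F_Q(A)` of the Maurer–Cartan equation. -/
def curvature [∀ k, FiniteDimensional ℝ (W k)] (Q : Differential U) (A : Form0 n W) : Form1 n W :=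
  fun k x => extDeriv (A k) x - FQ Q A k x

theorem defect_coordFn [∀ k, FiniteDimensional ℝ (W k)] (Q : Differential U)
    (hA : IsSmoothFormIn O U A) (hx : x ∈ O) (k : ℕ) (ξ : StrongDual ℝ (W k)) :
    defect Q A x (coordFn U k ξ) = ofForm (postcomp ξ (curvature Q A k x)) := by
  have hcoord : (fun y => evalAt U A y (coordFn U k ξ)) =ᶠ[𝓝 x]
      fun y => ofForm (postcomp ξ (A k y)) := by
    filter_upwards [hA.isOpen.mem_nhds hx] with y hy
    exact evalAt_coordFn (hA.mem y hy) k ξ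
  have hd : DifferentiableAt ℝ (A k) x :=
    ((hA.contDiffOn k).differentiableOn (by simp)).differentiableAt (hA.isOpen.mem_nhds hx)
  have hd' : DifferentiableAt ℝ (fun y => postcomp ξ (A k y)) x :=
    (postcomp ξ).differentiableAt.comp x hd
  have hQ : ofForm (postcomp ξ (FQ Q A k x)) = evalAt U A x (Q.Q (coordFn U k ξ)) := by
    rw [postcomp_FQ Q (hA.mem x hx),
      ofForm_toForm (evalAt_mem (hA.mem x hx) (Q.degree k _ (coordFn_mem_algDeg k ξ)))]
  rw [defect, dLam_congr hcoord, dLam_ofForm hd', extDeriv_postcomp ξ hd, ← hQ, curvature, map_sub,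
    map_sub]

theorem defect_tmul_one [FiniteDimensional ℝ (W 0)] (Q : Differential U)
    (hA : IsSmoothFormIn O U A) (hx : x ∈ O) (f : Smooth U) :
    defect Q A x (f ⊗ₜ 1) =
      defect Q A x (coordFn U 0 (fderiv ℝ (extendZero f) (A 0 x ![]))) := by
  let v : Smooth U →ₗ[ℝ] Lam n :=
    { toFun f := defect Q A x (f ⊗ₜ 1)
      map_add' f g := by rw [TensorProduct.add_tmul, defect_add Q hA hx]
      map_smul' r f := by rw [← TensorProduct.smul_tmul', defect_smul Q hA hx, RingHom.id_apply] }
  have heval (g : Smooth U) :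
      evalAt U A x (g ⊗ₜ 1) = algebraMap ℝ (Lam n) (g ⟨A 0 x ![], hA.mem x hx⟩) := by
    rw [evalAt_tmul (hA.mem x hx), map_one, extendZero_of_mem g (hA.mem x hx),
      Algebra.algebraMap_eq_smul_one]
  refine pointDerivation_eq (u := ⟨A 0 x ![], hA.mem x hx⟩) (v := v) (fun f g => ?_) f
  have hfg : (f * g) ⊗ₜ[ℝ] (1 : GradedSym W) = (f ⊗ₜ 1) * (g ⊗ₜ 1) := by
    rw [Algebra.TensorProduct.tmul_mul_tmul, one_mul]
  change defect Q A x ((f * g) ⊗ₜ 1) = _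
  rw [hfg, defect_mul Q hA hx (tmul_one_mem_algDeg f), heval, heval, pow_zero, one_smul,
    ← Algebra.smul_def, ← Algebra.commutes, ← Algebra.smul_def, add_comm]
  rfl

theorem isBigO_mul {Y : Type*} {l : Filter Y} {θ η : Y → Lam n} {c d : Y → ℝ} (hθ : θ =O[l] c)
    (hη : η =O[l] d) : (fun y => θ y * η y) =O[l] fun y => c y * d y :=
  (mulCLM n).isBoundedBilinearMap.isBigO_comp.trans (hθ.norm_left.mul hη.norm_left)

theorem IsSmoothFormIn.isBigO_evalAt (hA : IsSmoothFormIn O U A) (hS : IsCompact S) (hSO : S ⊆ O)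
    (F : Alg U) : (fun x => evalAt U A x F) =O[𝓟 S] fun _ => (1 : ℝ) :=
  ((hA.contDiffOn_evalAt F).continuousOn.mono hSO).isBigO_principal hS (by simp)

variable {c : E n → ℝ}

theorem isBigO_defect_add (Q : Differential U) (hA : IsSmoothFormIn O U A) (hSO : S ⊆ O)
    {F G : Alg U} (hF : (fun x => defect Q A x F) =O[𝓟 S] c)
    (hG : (fun x => defect Q A x G) =O[𝓟 S] c) : (fun x => defect Q A x (F + G)) =O[𝓟 S] c :=
  EventuallyEq.trans_isBigO (EqOn.eventuallyEq fun _ hx => defect_add Q hA (hSO hx) F G) (hF.add hG)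

theorem isBigO_defect_smul (Q : Differential U) (hA : IsSmoothFormIn O U A) (hSO : S ⊆ O) (r : ℝ)
    {F : Alg U} (hF : (fun x => defect Q A x F) =O[𝓟 S] c) :
    (fun x => defect Q A x (r • F)) =O[𝓟 S] c :=
  EventuallyEq.trans_isBigO (EqOn.eventuallyEq fun _ hx => defect_smul Q hA (hSO hx) r F)
    (hF.const_smul_left r)

theorem isBigO_defect_mul (Q : Differential U) (hA : IsSmoothFormIn O U A) (hS : IsCompact S)
    (hSO : S ⊆ O) {m : ℕ} {F G : Alg U} (hm : F ∈ algDeg U m)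
    (hF : (fun x => defect Q A x F) =O[𝓟 S] c) (hG : (fun x => defect Q A x G) =O[𝓟 S] c) :
    (fun x => defect Q A x (F * G)) =O[𝓟 S] c := by
  have hleft : (fun x => defect Q A x F * evalAt U A x G) =O[𝓟 S] c := by
    simpa using isBigO_mul hF (hA.isBigO_evalAt hS hSO G)
  have hright : (fun x => evalAt U A x F * defect Q A x G) =O[𝓟 S] c := by
    simpa using isBigO_mul (hA.isBigO_evalAt hS hSO F) hG
  exact EventuallyEq.trans_isBigO (EqOn.eventuallyEq fun _ hx => defect_mul Q hA (hSO hx) hm G)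
    (hleft.add (hright.const_smul_left ((-1 : ℝ) ^ m)))

variable [∀ k, FiniteDimensional ℝ (W k)]

theorem isBigO_defect_coordFn (Q : Differential U) (hA : IsSmoothFormIn O U A) (hSO : S ⊆ O)
    (k : ℕ) (hc : curvature Q A k =O[𝓟 S] c) (ξ : StrongDual ℝ (W k)) :
    (fun x => defect Q A x (coordFn U k ξ)) =O[𝓟 S] c :=
  EventuallyEq.trans_isBigO (EqOn.eventuallyEq fun _ hx => defect_coordFn Q hA (hSO hx) k ξ) <|
    (((LinearMap.toContinuousLinearMap ofForm).comp (postcomp ξ)).isBigO_comp _ _).trans hc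

theorem isBigO_defect_tmul_one (Q : Differential U) (hA : IsSmoothFormIn O U A) (hS : IsCompact S)
    (hSO : S ⊆ O) (hc : curvature Q A 0 =O[𝓟 S] c) (f : Smooth U) :
    (fun x => defect Q A x (f ⊗ₜ 1)) =O[𝓟 S] c := by
  set η : E n → StrongDual ℝ (W 0) := fun x => fderiv ℝ (extendZero f) (A 0 x ![])
  have hη : ContinuousOn η O :=
    ((contDiffOn_extendZero f).continuousOn_fderiv_of_isOpen U.isOpen (by simp)).comp
      (contDiffOn_zeroForm (hA.contDiffOn 0)).continuousOn hA.mem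
  have hη_bdd : η =O[𝓟 S] fun _ => (1 : ℝ) := (hη.mono hSO).isBigO_principal hS (by simp)
  have hpost : (fun x => postcomp (η x) (curvature Q A 0 x)) =O[𝓟 S] c := by
    refine (IsBigO.of_norm_le fun x => ?_).trans (by simpa using hη_bdd.norm_left.mul hc.norm_left)
    exact (η x).norm_compContinuousAlternatingMap_le _
  refine EventuallyEq.trans_isBigO (EqOn.eventuallyEq fun x hx => ?_)
    (((LinearMap.toContinuousLinearMap ofForm).isBigO_comp _ _).trans hpost)
  exact (defect_tmul_one Q hA (hSO hx) f).trans (defect_coordFn Q hA (hSO hx) 0 (η x))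

theorem isBigO_defect_one_tmul_mul (Q : Differential U) (hA : IsSmoothFormIn O U A)
    (hS : IsCompact S) (hSO : S ⊆ O) (hc : ∀ k, curvature Q A k =O[𝓟 S] c) (s : GradedSym W)
    {G : Alg U} (hG : (fun x => defect Q A x G) =O[𝓟 S] c) :
    (fun x => defect Q A x ((1 : Smooth U) ⊗ₜ[ℝ] s * G)) =O[𝓟 S] c := by
  induction s using gradedSym_induction generalizing G with
  | algebraMap r =>
    have hr : (1 : Smooth U) ⊗ₜ[ℝ] algebraMap ℝ (GradedSym W) r * G = r • G := by
      rw [Algebra.algebraMap_eq_smul_one, TensorProduct.tmul_smul, smul_mul_assoc,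
        ← Algebra.TensorProduct.one_def, one_mul]
    rw [hr]
    exact isBigO_defect_smul Q hA hSO r hG
  | sgen k ξ =>
    exact isBigO_defect_mul Q hA hS hSO (coordFn_mem_algDeg (k + 1) ξ)
      (isBigO_defect_coordFn Q hA hSO (k + 1) (hc _) ξ) hG
  | add a b ha hb =>
    rw [TensorProduct.tmul_add, add_mul]
    exact isBigO_defect_add Q hA hSO (ha hG) (hb hG)
  | mul a b ha hb =>
    have hab : (1 : Smooth U) ⊗ₜ[ℝ] (a * b) = (1 ⊗ₜ a) * (1 ⊗ₜ b) := by
      rw [Algebra.TensorProduct.tmul_mul_tmul, one_mul]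
    rw [hab, mul_assoc]
    exact ha (hb hG)

theorem isBigO_defect (Q : Differential U) (hA : IsSmoothFormIn O U A) (hS : IsCompact S)
    (hSO : S ⊆ O) (hc : ∀ k, curvature Q A k =O[𝓟 S] c) (F : Alg U) :
    (fun x => defect Q A x F) =O[𝓟 S] c := by
  induction F using TensorProduct.induction_on with
  | zero => simpa using isBigO_defect_smul Q hA hSO 0 (isBigO_defect_tmul_one Q hA hS hSO (hc 0) 0)
  | tmul f s =>
    have hfs : f ⊗ₜ[ℝ] s = (1 : Smooth U) ⊗ₜ[ℝ] s * (f ⊗ₜ 1) := by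
      rw [Algebra.TensorProduct.tmul_mul_tmul, one_mul, mul_one]
    rw [hfs]
    exact isBigO_defect_one_tmul_mul Q hA hS hSO hc s (isBigO_defect_tmul_one Q hA hS hSO (hc 0) f)
  | add F G hF hG => exact isBigO_defect_add Q hA hSO hF hG

theorem postcomp_extDeriv_FQ (Q : Differential U) (hA : IsSmoothFormIn O U A) (hx : x ∈ O) (k : ℕ)
    (ξ : StrongDual ℝ (W k)) :
    postcomp ξ (extDeriv (FQ Q A k) x) =
      toForm n (k + 2) (defect Q A x (Q.Q (coordFn U k ξ))) := by
  have hFQ : (fun y => postcomp ξ (FQ Q A k y)) =ᶠ[𝓝 x]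
      fun y => toForm n (k + 1) (evalAt U A y (Q.Q (coordFn U k ξ))) := by
    filter_upwards [hA.isOpen.mem_nhds hx] with y hy
    exact postcomp_FQ Q (hA.mem y hy) k ξ
  have hd : DifferentiableAt ℝ (FQ Q A k) x :=
    ((hA.contDiffOn_FQ Q k).differentiableOn (by simp)).differentiableAt (hA.isOpen.mem_nhds hx)
  rw [← extDeriv_postcomp ξ hd, hFQ.extDeriv_eq, defect, Q.sq_zero, map_zero, sub_zero,
    toForm_dLam (hA.differentiableAt_evalAt hx _)]

theorem isBigO_extDeriv_FQ (Q : Differential U) (hA : IsSmoothFormIn O U A) (hS : IsCompact S)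
    (hSO : S ⊆ O) (hc : ∀ k, curvature Q A k =O[𝓟 S] c) (k : ℕ) :
    extDeriv (FQ Q A k) =O[𝓟 S] c :=
  isBigO_of_postcomp fun ξ =>
    EventuallyEq.trans_isBigO (EqOn.eventuallyEq fun _ hx => postcomp_extDeriv_FQ Q hA (hSO hx) k ξ)
      (((LinearMap.toContinuousLinearMap (toForm n (k + 2))).isBigO_comp _ _).trans
        (isBigO_defect Q hA hS hSO hc _))

end Defect

section Gronwall

theorem eq_zero_of_le_mul_integral {γ : ℝ → ℝ} {M a b : ℝ} (hγ : ContinuousOn γ (Icc a b))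
    (hnonneg : ∀ s ∈ Icc a b, 0 ≤ γ s) (hle : ∀ s ∈ Icc a b, γ s ≤ M * ∫ t in a..s, γ t) :
    ∀ s ∈ Icc a b, γ s = 0 := by
  intro s hs
  have hint : MeasureTheory.IntegrableOn γ (uIcc a b) := by
    rw [uIcc_of_le (hs.1.trans hs.2)]
    exact hγ.integrableOn_Icc
  have hderiv : ∀ u ∈ Ico a b, HasDerivWithinAt (fun u => ∫ t in a..u, γ t) (γ u) (Ici u) u := by
    intro u hu
    have hIoo : 𝓝[Ioo u b] u = 𝓝[>] u := nhdsWithin_Ioo_eq_nhdsGT hu.2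
    have hsub : Ioo u b ⊆ Icc a b := fun t ht => ⟨hu.1.trans ht.1.le, ht.2.le⟩
    refine intervalIntegral.integral_hasDerivWithinAt_right (t := Ioi u)
      ((hγ.mono (Icc_subset_Icc_right hu.2.le)).intervalIntegrable_of_Icc hu.1) ?_ ?_
    · rw [← hIoo]
      exact (hγ.mono hsub).stronglyMeasurableAtFilter_nhdsWithin measurableSet_Ioo u
    · rw [ContinuousWithinAt, ← hIoo]
      exact (hγ u (Ico_subset_Icc_self hu)).mono hsub
  have hzero := eq_zero_of_abs_deriv_le_mul_abs_self_of_eq_zero_right (K := M)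
    (uIcc_of_le (hs.1.trans hs.2) ▸ intervalIntegral.continuousOn_primitive_interval hint) hderiv
    intervalIntegral.integral_same fun u hu => ?_
  · exact le_antisymm (by simpa [hzero s hs] using hle s hs) (hnonneg s hs)
  · have hint_nonneg : 0 ≤ ∫ t in a..u, γ t :=
      intervalIntegral.integral_nonneg hu.1 fun t ht => hnonneg t ⟨ht.1, ht.2.trans hu.2.le⟩
    rw [Real.norm_of_nonneg (hnonneg u (Ico_subset_Icc_self hu)), Real.norm_of_nonneg hint_nonneg]
    exact hle u (Ico_subset_Icc_self hu)

theorem norm_hOp_smul_le {n k : ℕ} {F : Type*} [NormedAddCommGroup F] [NormedSpace ℝ F]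
    {α : E n → E n [⋀^Fin (k + 1)]→L[ℝ] F} {x : E n} {s : ℝ} (hs : 0 ≤ s) {γ : ℝ → ℝ}
    (hγ : ContinuousOn γ (Icc 0 s)) (hα : ∀ t ∈ Icc 0 s, ‖α (t • x)‖ ≤ γ t) :
    ‖hOp α (s • x)‖ ≤ ‖x‖ * ∫ t in (0 : ℝ)..s, γ t := by
  have hmaps : MapsTo (fun t : ℝ => t * s) (Icc 0 1) (Icc 0 s) := fun t ht =>
    ⟨mul_nonneg ht.1 hs, mul_le_of_le_one_left hs ht.2⟩
  have hint : IntervalIntegrable (fun t => s * ‖x‖ * γ (t * s)) MeasureTheory.volume 0 1 :=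
    (continuousOn_const.mul (hγ.comp (by fun_prop) hmaps)).intervalIntegrable_of_Icc zero_le_one
  have hintegrand (t : ℝ) (ht : t ∈ Icc (0 : ℝ) 1) :
      ‖t ^ k • (α (t • s • x)).curryLeft (s • x)‖ ≤ s * ‖x‖ * γ (t * s) :=
    calc ‖t ^ k • (α (t • s • x)).curryLeft (s • x)‖
      _ ≤ ‖(α (t • s • x)).curryLeft (s • x)‖ := by
        rw [norm_smul, norm_pow, Real.norm_of_nonneg ht.1]
        exact mul_le_of_le_one_left (norm_nonneg _) (pow_le_one₀ ht.1 ht.2)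
      _ ≤ ‖α ((t * s) • x)‖ * ‖s • x‖ := by
        rw [smul_smul, ← ContinuousAlternatingMap.norm_curryLeft]
        exact ContinuousLinearMap.le_opNorm _ _
      _ ≤ γ (t * s) * (s * ‖x‖) := by
        rw [norm_smul, Real.norm_of_nonneg hs]
        gcongr
        exact hα _ (hmaps ht)
      _ = s * ‖x‖ * γ (t * s) := mul_comm _ _
  calc ‖hOp α (s • x)‖
    _ ≤ ∫ t in (0 : ℝ)..1, s * ‖x‖ * γ (t * s) :=
      intervalIntegral.norm_integral_le_of_norm_le zero_le_one
        (Eventually.of_forall fun t ht => hintegrand t (Ioc_subset_Icc_self ht)) hint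
    _ = ‖x‖ * (s * ∫ t in (0 : ℝ)..1, γ (t * s)) := by
      rw [intervalIntegral.integral_const_mul]
      ring
    _ = ‖x‖ * ∫ t in (0 : ℝ)..s, γ t := by
      rw [intervalIntegral.mul_integral_comp_mul_right, zero_mul, one_mul]

end Gronwall

section MaurerCartan

open Asymptotics

theorem subsingleton_alternating_of_finrank_lt {V F : Type*} [NormedAddCommGroup V]
    [NormedSpace ℝ V] [FiniteDimensional ℝ V] [NormedAddCommGroup F] [NormedSpace ℝ F] {k : ℕ}
    (hk : Module.finrank ℝ V < k) : Subsingleton (V [⋀^Fin k]→L[ℝ] F) := by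
  refine subsingleton_of_forall_eq 0 fun β => ?_
  ext v
  refine β.toAlternatingMap.map_linearDependent v fun hv => ?_
  simpa using hv.fintype_card_le_finrank.trans_lt hk

variable {W : ℕ → Type*} [∀ k, NormedAddCommGroup (W k)] [∀ k, NormedSpace ℝ (W k)]
  [∀ k, FiniteDimensional ℝ (W k)] {n : ℕ} {U : Opens (W 0)}

/-- The sum of the norms of the components of `dA - F_Q(A)` at a point; the components of form
degree greater than `n` vanish. -/
def curvatureNorm (Q : Differential U) (A : Form0 n W) (x : E n) : ℝ :=
  ∑ k ∈ Finset.range n, ‖curvature Q A k x‖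

theorem curvatureNorm_nonneg (Q : Differential U) (A : Form0 n W) (x : E n) :
    0 ≤ curvatureNorm Q A x :=
  Finset.sum_nonneg fun _ _ => norm_nonneg _

theorem norm_curvature_le (Q : Differential U) (A : Form0 n W) (k : ℕ) (x : E n) :
    ‖curvature Q A k x‖ ≤ curvatureNorm Q A x := by
  by_cases hk : k < n
  · exact Finset.single_le_sum (f := fun k => ‖curvature Q A k x‖) (fun _ _ => norm_nonneg _)
      (Finset.mem_range.2 hk)
  · have : Subsingleton (E n [⋀^Fin (k + 1)]→L[ℝ] W k) :=
      subsingleton_alternating_of_finrank_lt (by simpa using not_lt.1 hk)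
    rw [Subsingleton.elim (curvature Q A k x) 0, norm_zero]
    exact curvatureNorm_nonneg Q A x

variable {A : Form0 n W} {O N : Set (E n)} {x : E n}

theorem IsSmoothFormIn.continuousOn_curvatureNorm (hA : IsSmoothFormIn O U A)
    (Q : Differential U) : ContinuousOn (curvatureNorm Q A) O :=
  continuousOn_finsetSum _ fun k _ =>
    ((contDiffOn_extDeriv (m := ∞) hA.isOpen (hA.contDiffOn k) le_rfl).sub
      (hA.contDiffOn_FQ Q k)).continuousOn.norm

theorem exists_norm_extDeriv_FQ_le (Q : Differential U) (hA : IsSmoothFormIn O U A)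
    {S : Set (E n)} (hS : IsCompact S) (hSO : S ⊆ O) (k : ℕ) :
    ∃ K, ∀ x ∈ S, ‖extDeriv (FQ Q A k) x‖ ≤ K * curvatureNorm Q A x := by
  obtain ⟨K, hK⟩ := isBigO_principal.1 <| isBigO_extDeriv_FQ Q hA hS hSO
    (fun j => IsBigO.of_norm_le (norm_curvature_le Q A j)) k
  refine ⟨K, fun x hx => ?_⟩
  simpa [Real.norm_of_nonneg (curvatureNorm_nonneg Q A x)] using hK x hx

theorem IsSmoothFormIn.contDiffOn_kuranishi (hA : IsSmoothFormIn O U A) (hO : StarConvex ℝ 0 O)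
    (Q : Differential U) (k : ℕ) : ContDiffOn ℝ ∞ (kuranishi Q A k) O :=
  (hA.contDiffOn k).sub (contDiffOn_hOp hA.isOpen hO (hA.contDiffOn_FQ Q k))

theorem extDeriv_kuranishi (Q : Differential U) (hA : IsSmoothFormIn O U A)
    (hO : StarConvex ℝ 0 O) (hx : x ∈ O) (k : ℕ) :
    extDeriv (kuranishi Q A k) x = curvature Q A k x + hOp (extDeriv (FQ Q A k)) x := by
  have : CompleteSpace (W k) := FiniteDimensional.complete ℝ (W k)
  have hO_nhds := hA.isOpen.mem_nhds hx
  have hFQ := hA.contDiffOn_FQ Q k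
  have hd_kuranishi : DifferentiableAt ℝ (kuranishi Q A k) x :=
    ((hA.contDiffOn_kuranishi hO Q k).differentiableOn (by simp)).differentiableAt hO_nhds
  have hd_hOp : DifferentiableAt ℝ (hOp (FQ Q A k)) x :=
    ((contDiffOn_hOp hA.isOpen hO hFQ).differentiableOn (by simp)).differentiableAt hO_nhds
  have hA_eq : A k = kuranishi Q A k + hOp (FQ Q A k) := funext fun y => (sub_add_cancel _ _).symm
  rw [curvature, hA_eq, extDeriv_add hd_kuranishi hd_hOp, ← extDeriv_hOp_add hA.isOpen hO hFQ hx]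
  abel

theorem hOp_congr {k : ℕ} {F : Type*} [NormedAddCommGroup F] [NormedSpace ℝ F]
    (hN : StarConvex ℝ 0 N) {α β : E n → E n [⋀^Fin (k + 1)]→L[ℝ] F} (h : EqOn α β N) :
    EqOn (hOp α) (hOp β) N := fun x hx =>
  intervalIntegral.integral_congr fun t ht => by
    simp only [h (smul_mem_of_starConvex hN hx t ht)]

theorem extDeriv_FQ_eq_zero (Q : Differential U) (hA : IsSmoothFormIn O U A) (hx : x ∈ O)
    (hcurv : ∀ k, curvature Q A k x = 0) (k : ℕ) : extDeriv (FQ Q A k) x = 0 := by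
  obtain ⟨K, hK⟩ :=
    exists_norm_extDeriv_FQ_le Q hA isCompact_singleton (singleton_subset_iff.2 hx) k
  simpa [curvatureNorm, hcurv] using hK x rfl

theorem curvature_eq_zero (Q : Differential U) (hA : IsSmoothFormIn O U A)
    (hseg : ∀ t ∈ Icc (0 : ℝ) 1, t • x ∈ O)
    (hcurv : ∀ k, ∀ t ∈ Icc (0 : ℝ) 1,
      curvature Q A k (t • x) + hOp (extDeriv (FQ Q A k)) (t • x) = 0) (k : ℕ) :
    curvature Q A k x = 0 := by
  set γ : ℝ → ℝ := fun t => curvatureNorm Q A (t • x)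
  have hγ : ContinuousOn γ (Icc 0 1) := (hA.continuousOn_curvatureNorm Q).comp (by fun_prop) hseg
  have hS : IsCompact ((fun t : ℝ => t • x) '' Icc 0 1) := isCompact_Icc.image (by fun_prop)
  choose K hK using exists_norm_extDeriv_FQ_le Q hA hS (image_subset_iff.2 hseg)
  have hnorm (k : ℕ) (s : ℝ) (hs : s ∈ Icc (0 : ℝ) 1) :
      ‖curvature Q A k (s • x)‖ ≤ ‖x‖ * K k * ∫ t in (0 : ℝ)..s, γ t := by
    have hsub : Icc 0 s ⊆ Icc (0 : ℝ) 1 := Icc_subset_Icc_right hs.2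
    rw [eq_neg_of_add_eq_zero_left (hcurv k s hs), norm_neg, mul_assoc,
      ← intervalIntegral.integral_const_mul]
    exact norm_hOp_smul_le hs.1 (continuousOn_const.mul (hγ.mono hsub))
      fun t ht => hK k _ (mem_image_of_mem _ (hsub ht))
  have hγ_le (s : ℝ) (hs : s ∈ Icc (0 : ℝ) 1) :
      γ s ≤ (∑ k ∈ Finset.range n, ‖x‖ * K k) * ∫ t in (0 : ℝ)..s, γ t := by
    rw [Finset.sum_mul]
    exact Finset.sum_le_sum fun k _ => hnorm k s hs
  have hγ_one : γ 1 = 0 :=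
    eq_zero_of_le_mul_integral hγ (fun _ _ => curvatureNorm_nonneg Q A _) hγ_le 1 (by simp)
  have hle := norm_curvature_le Q A k ((1 : ℝ) • x)
  rw [show curvatureNorm Q A ((1 : ℝ) • x) = 0 from hγ_one, one_smul] at hle
  exact norm_le_zero_iff.1 hle

theorem forall_curvature_eq_zero_iff (Q : Differential U) (hA : IsSmoothFormIn O U A)
    (hO : StarConvex ℝ 0 O) (hN : StarConvex ℝ 0 N) (hNO : N ⊆ O) :
    (∀ k, ∀ x ∈ N, curvature Q A k x = 0) ↔
      ∀ k, ∀ x ∈ N, extDeriv (kuranishi Q A k) x = 0 := by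
  refine ⟨fun h k x hx => ?_, fun h k x hx => ?_⟩
  · have hFQ : EqOn (extDeriv (FQ Q A k)) 0 N := fun y hy =>
      extDeriv_FQ_eq_zero Q hA (hNO hy) (fun j => h j y hy) k
    rw [extDeriv_kuranishi Q hA hO (hNO hx), h k x hx, hOp_congr hN hFQ hx]
    simp [hOp]
  · have hseg (t : ℝ) (ht : t ∈ Icc (0 : ℝ) 1) : t • x ∈ N := starConvex_zero_iff.1 hN hx ht.1 ht.2
    refine curvature_eq_zero Q hA (fun t ht => hNO (hseg t ht)) (fun j t ht => ?_) k
    rw [← extDeriv_kuranishi Q hA hO (hNO (hseg t ht)), h j _ (hseg t ht)]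

end MaurerCartan

section Corners

variable {n : ℕ} {N : Set (E n)}

theorem uniqueDiffOn_quadrant (S : Set (Fin n)) : UniqueDiffOn ℝ {y : E n | ∀ i ∈ S, 0 ≤ y i} := by
  refine uniqueDiffOn_convex (fun y hy z hz a b ha hb _ i hi => ?_) ?_
  · have hyi := hy i hi
    have hzi := hz i hi
    simp only [PiLp.add_apply, PiLp.smul_apply, smul_eq_mul]
    positivity
  · have hopen : IsOpen {y : E n | ∀ i, 0 < y i} := by
      simp only [Set.ofPred_forall]
      exact isOpen_iInter_of_finite fun _ => isOpen_lt continuous_const (by fun_prop)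
    exact ⟨WithLp.toLp 2 fun _ => 1, mem_interior.2 ⟨{y : E n | ∀ i, 0 < y i},
      fun y hy i _ => (hy i).le, hopen, fun _ => by simp⟩⟩

theorem IsSubmanifoldWithCorners.uniqueDiffOn (hN : IsSubmanifoldWithCorners N) :
    UniqueDiffOn ℝ N := by
  intro x hx
  obtain ⟨φ, S, hxs, hφ, hφ_symm, hS⟩ := hN x hx
  have hxt : φ x ∈ φ.target := φ.map_source hxs
  have hdφ : HasFDerivAt φ (fderiv ℝ φ x) x :=
    ((hφ.differentiableOn (by simp)).differentiableAt (φ.open_source.mem_nhds hxs)).hasFDerivAt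
  have hdφ_symm : HasFDerivAt φ.symm (fderiv ℝ φ.symm (φ x)) (φ x) :=
    ((hφ_symm.differentiableOn (by simp)).differentiableAt (φ.open_target.mem_nhds hxt)).hasFDerivAt
  have hcomp : (fderiv ℝ φ.symm (φ x)).comp (fderiv ℝ φ x) = ContinuousLinearMap.id ℝ (E n) :=
    (hdφ_symm.comp x hdφ).unique
      ((hasFDerivAt_id x).congr_of_eventuallyEq (φ.eventually_left_inverse hxs))
  have hsurj : Function.Surjective (fderiv ℝ φ.symm (φ x)) := fun v =>
    ⟨fderiv ℝ φ x v, DFunLike.congr_fun hcomp v⟩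
  have hquad : UniqueDiffWithinAt ℝ ({y : E n | ∀ i ∈ S, 0 ≤ y i} ∩ φ.target) (φ x) :=
    (uniqueDiffOn_quadrant S _ ((hS x hxs).1 hx)).inter (φ.open_target.mem_nhds hxt)
  have himage := hdφ_symm.hasFDerivWithinAt.uniqueDiffWithinAt hquad hsurj.denseRange
  rw [φ.left_inv hxs] at himage
  refine himage.mono ?_
  rintro _ ⟨y, ⟨hy, hyt⟩, rfl⟩
  rw [hS _ (φ.map_target hyt), φ.right_inv hyt]
  exact hy

theorem extDerivWithin_eq_extDeriv {X F : Type*} [NormedAddCommGroup X] [NormedSpace ℝ X]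
    [NormedAddCommGroup F] [NormedSpace ℝ F] {k : ℕ} {α β : X → X [⋀^Fin k]→L[ℝ] F} {s : Set X}
    {x : X} (hs : UniqueDiffWithinAt ℝ s x) (hβ : DifferentiableAt ℝ β x) (h : EqOn α β s)
    (hx : x ∈ s) : extDerivWithin α s x = extDeriv β x := by
  rw [extDerivWithin_congr' h hx, extDerivWithin, extDeriv, hβ.fderivWithin hs]

end Corners

section Extension

variable {W : ℕ → Type*} [∀ k, NormedAddCommGroup (W k)] [∀ k, NormedSpace ℝ (W k)] {n : ℕ}
  {U : Opens (W 0)} {N : Set (E n)} {A B : Form0 n W}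

theorem exists_isOpen_starConvex {X : Type*} [AddCommGroup X] [Module ℝ X] [TopologicalSpace X]
    [ContinuousSMul ℝ X] {N O : Set X} (hO : IsOpen O) (hN : StarConvex ℝ 0 N) (hNO : N ⊆ O) :
    ∃ O' ⊆ O, IsOpen O' ∧ StarConvex ℝ 0 O' ∧ N ⊆ O' := by
  refine ⟨{x | ∀ t ∈ Icc (0 : ℝ) 1, t • x ∈ O}, fun x hx => ?_, ?_, ?_, fun x hx t ht =>
    hNO (starConvex_zero_iff.1 hN hx ht.1 ht.2)⟩
  · simpa using hx 1 (by simp)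
  · refine isOpen_iff_mem_nhds.2 fun x hx =>
      isCompact_Icc.eventually_forall_of_forall_eventually fun t ht => ?_
    have hsmul : Continuous fun p : X × ℝ => p.2 • p.1 := by fun_prop
    exact hsmul.continuousAt.eventually (hO.mem_nhds (hx t ht))
  · refine starConvex_zero_iff.2 fun x hx t ht₀ ht₁ s hs => ?_
    rw [smul_smul]
    exact hx _ ⟨mul_nonneg hs.1 ht₀, mul_le_one₀ hs.2 ht₀ ht₁⟩

theorem IsForm0In.exists_isSmoothFormIn (hA : IsForm0In N U A) (hN : StarConvex ℝ 0 N) :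
    ∃ (O : Set (E n)) (B : Form0 n W), IsSmoothFormIn O U B ∧ StarConvex ℝ 0 O ∧ N ⊆ O ∧
      ∀ k, EqOn (A k) (B k) N := by
  obtain ⟨hA, hAU⟩ := hA
  choose O B hO hNO hB hAB using hA
  set O₁ := ⋂ k ∈ Finset.range (n + 1), O k
  have hO₁ : IsOpen O₁ := isOpen_biInter_finset fun k _ => hO k
  have hB₁ (k : ℕ) : ContDiffOn ℝ ∞ (B k) O₁ := by
    by_cases hk : k < n + 1
    · exact (hB k).mono (biInter_subset_of_mem (Finset.mem_range.2 hk))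
    · have : Subsingleton (E n [⋀^Fin k]→L[ℝ] W k) :=
        subsingleton_alternating_of_finrank_lt (by simpa using hk)
      exact contDiff_of_subsingleton.contDiffOn
  have hO₂ := (contDiffOn_zeroForm (hB₁ 0)).continuousOn.isOpen_inter_preimage hO₁ U.isOpen
  have hNO₂ : N ⊆ O₁ ∩ (fun x => B 0 x ![]) ⁻¹' U :=
    subset_inter (subset_iInter₂ fun k _ => hNO k) fun x hx => by
      rw [mem_preimage, ← hAB 0 hx]
      exact hAU x hx
  obtain ⟨O', hO'_sub, hO'_open, hO'_star, hNO'⟩ := exists_isOpen_starConvex hO₂ hN hNO₂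
  exact ⟨O', B, ⟨hO'_open, fun k => (hB₁ k).mono fun x hx => (hO'_sub hx).1,
    fun x hx => (hO'_sub hx).2⟩, hO'_star, hNO', hAB⟩

theorem dForm_eq_extDeriv {O : Set (E n)} (hN : UniqueDiffOn ℝ N) (hO : IsOpen O) (hNO : N ⊆ O)
    {k : ℕ} (hB : ContDiffOn ℝ ∞ (B k) O) (h : EqOn (A k) (B k) N) {x : E n} (hx : x ∈ N) :
    dForm N A k x = extDeriv (B k) x :=
  extDerivWithin_eq_extDeriv (hN x hx)
    ((hB.differentiableOn (by simp)).differentiableAt (hO.mem_nhds (hNO hx))) h hx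

variable [∀ k, FiniteDimensional ℝ (W k)]

theorem FQ_congr (Q : Differential U) {x : E n} (h : ∀ k, A k x = B k x) (k : ℕ) :
    FQ Q A k x = FQ Q B k x := by
  have hconst : FQ Q A k x = FQ Q (fun j _ => A j x) k x := rfl
  rw [hconst, funext fun j => congrArg (fun a (_ : E n) => a) (h j)]
  rfl

theorem eqOn_kuranishi (Q : Differential U) (hN : StarConvex ℝ 0 N)
    (h : ∀ k, EqOn (A k) (B k) N) (k : ℕ) : EqOn (kuranishi Q A k) (kuranishi Q B k) N := by
  have hFQ : EqOn (FQ Q A k) (FQ Q B k) N := fun y hy => FQ_congr Q (fun j => h j hy) k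
  intro x hx
  rw [kuranishi, kuranishi, h k hx, hOp_congr hN hFQ hx]

end Extension

end GradedMC

end

open GradedMC in
theorem mainTheorem2_general {n : ℕ} {N : Set (E n)} (hN : UniqueDiffOn ℝ N)
    (hstar : StarConvex ℝ 0 N) {W : ℕ → Type*} [∀ k, NormedAddCommGroup (W k)]
    [∀ k, NormedSpace ℝ (W k)] [∀ k, FiniteDimensional ℝ (W k)]
    {U : TopologicalSpace.Opens (W 0)} (Q : Differential U) {A : Form0 n W}
    (hA : IsForm0In N U A) :
    IsForm0 N (kuranishi Q A) ∧
      ((∀ k, ∀ x ∈ N, dForm N A k x = FQ Q A k x) ↔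
        ∀ k, ∀ x ∈ N, dForm N (kuranishi Q A) k x = 0) := by
  obtain ⟨O, B, hB, hO, hNO, hAB⟩ := hA.exists_isSmoothFormIn hstar
  have hkuranishi := hB.contDiffOn_kuranishi hO Q
  have heqOn := eqOn_kuranishi Q hstar hAB
  have hcurvature (k : ℕ) (x : E n) (hx : x ∈ N) :
      dForm N A k x = FQ Q A k x ↔ curvature Q B k x = 0 := by
    rw [dForm_eq_extDeriv hN hB.isOpen hNO (hB.contDiffOn k) (hAB k) hx,
      FQ_congr Q fun j => hAB j hx, curvature, sub_eq_zero]
  have hclosed (k : ℕ) (x : E n) (hx : x ∈ N) :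
      dForm N (kuranishi Q A) k x = extDeriv (kuranishi Q B k) x :=
    dForm_eq_extDeriv hN hB.isOpen hNO (hkuranishi k) (heqOn k) hx
  refine ⟨fun k => ⟨O, _, hB.isOpen, hNO, hkuranishi k, heqOn k⟩, ?_⟩
  rw [forall₃_congr hcurvature, forall_curvature_eq_zero_iff Q hB hO hstar hNO]
  exact forall₃_congr fun k x hx => by rw [hclosed k x hx]

theorem mainTheorem2 {n : ℕ} (N : Set (GradedMC.E n))
    (hN : GradedMC.IsSubmanifoldWithCorners N) (hstar : StarConvex ℝ 0 N)
    {W : ℕ → Type*} [∀ k, NormedAddCommGroup (W k)] [∀ k, NormedSpace ℝ (W k)]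
    [∀ k, FiniteDimensional ℝ (W k)] (hW : {k | Nontrivial (W k)}.Finite)
    (U : TopologicalSpace.Opens (W 0)) (Q : GradedMC.Differential U)
    (A : GradedMC.Form0 n W) (hA : GradedMC.IsForm0In N U A) :
    GradedMC.IsForm0 N (GradedMC.kuranishi Q A) ∧
      ((∀ k, ∀ x ∈ N, GradedMC.dForm N A k x = GradedMC.FQ Q A k x) ↔
        ∀ k, ∀ x ∈ N, GradedMC.dForm N (GradedMC.kuranishi Q A) k x = 0) :=
  mainTheorem2_general hN.uniqueDiffOn hstar Q hA
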